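/- Let $\mathcal L$ be an element of the extended Selberg class: $\mathcal L(s)=\sum_{n\ge1}f(n)n^{-s}$ converges absolutely for $\operatorname{Re}s>1$, $(s-1)^k\mathcal L(s)$ extends to an entire function of finite order for some integer $k\ge0$, and, as meromorphic functions, $\mathfrak L(s)=\omega\,\overline{\mathfrak L(1-\overline s)}$, where $\mathfrak L(s)=\mathcal L(s)Q^s\prod_{j\le r}\Gamma(\lambda_js+\mu_j)$ with $Q>0$, $\lambda_j>0$, $\operatorname{Re}\mu_j\ge0$ and $|\omega|=1$. Put $$d_{\mathcal L}=2\sum_{j\le r}\lambda_j,\qquad \lambda=\prod_{j\le r}\lambda_j^{2\lambda_j},\qquad \Theta=\operatorname{Im}\Big(2\sum_{j\le r}\big(\mu_j-\tfrac12\big)\Big),$$ $$\Delta_{\mathcal L}(s)=\omega Q^{1-2s}\prod_{j\le r}\frac{\Gamma(\lambda_j(1-s)+\overline{\mu_j})}{\Gamma(\lambda_js+\mu_j)},\qquad \psi(t)=\frac{\log t}{\log\log t},$$ and assume $d_{\mathcal L}\ge1$. Let $a\ne0$ be a complex number, and let $\delta_a=\beta_a+i\gamma_a$ denote the nontrivial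 $a$-points of $\Delta_{\mathcal L}$, that is, the solutions of $\Delta_{\mathcal L}(s)=a$ with $0\le\operatorname{Re}s\le1$, counted with multiplicity. (i) Let $y$ be a real function such that $2\le y(t)$ and $4|\Theta|\,y(t)\le t$ for all sufficiently large $t$. Then there are $T_0>0$ and $C$, depending only on $a$, $\mathcal L$ (including the data of its functional equation) and $y$, such that for all $T\ge T_0$ and all real $x>0$, $x\ne1$, with $$\max\Big\{x,\frac1x\Big\}\le\Big(1-\frac1{y(T)}\Big)\lambda Q^2T^{d_{\mathcal L}}$$ there are only finitely many nontrivial $a$-points with $T<\gamma_a\le2T$, and $$\Big|\sum_{T<\gamma_a\le2T}x^{i\gamma_a}\Big|\le C\,(1+|\log x|)\left(\frac{\log T}{|\log x|}+\psi(T)+y(T)|\log x|\right).$$ (ii) The nontrivial $a$-points with $\gamma_a>0$ can be listed, each as often as its multiplicity, as an infinite sequence with non-decreasing ordinates $(\gamma_a)_{\gamma_a>0}$, and for every such listing and every real $\alpha\ne0$ the sequence $(\alpha\gamma_a)_{\gamma_a>0}$ is uniformly distributed modulo one: for all $0\le b\le c\le1$ the proportion of those among its first $N$ terms whose fractional part lies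 in $[b,c]$ tends to $c-b$ as $N\to\infty$. -/

import Mathlib

open Filter Topology

noncomputable section

namespace SelbergDelta

/-- The data `r`, `Q`, `λ_j`, `μ_j`, `ω` of a Riemann-type functional equation:
`Q > 0`, `λ_j > 0`, `Re μ_j ≥ 0` and `|ω| = 1`. -/
structure GammaData where
  r : ℕ
  Q : ℝ
  lam : Fin r → ℝ
  mu : Fin r → ℂ
  omega : ℂ
  Q_pos : 0 < Q
  lam_pos : ∀ j, 0 < lam j
  mu_re_nonneg : ∀ j, 0 ≤ (mu j).re
  norm_omega : ‖omega‖ = 1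

namespace GammaData

variable (D : GammaData)

/-- The degree `d = 2 ∑ λ_j`. -/
def degree : ℝ := 2 * ∑ j, D.lam j

/-- The number `λ = ∏ λ_j ^ (2 λ_j)`. -/
def lamProd : ℝ := ∏ j, D.lam j ^ (2 * D.lam j)

/-- The number `ξ = 2 ∑ (μ_j - 1/2) = η + iΘ`. -/
def xi : ℂ := 2 * ∑ j, (D.mu j - 1 / 2)

/-- The shift `Θ = Im ξ`. -/
def Theta : ℝ := D.xi.im

/-- The Gamma factor `Q ^ s ∏ Γ(λ_j s + μ_j)`. -/
def gammaFactor (s : ℂ) : ℂ :=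
  (D.Q : ℂ) ^ s * ∏ j, Complex.Gamma (D.lam j * s + D.mu j)

/-- `s` is not a pole of any of the factors `Γ(λ_j s + μ_j)`. -/
def GammaRegularAt (s : ℂ) : Prop :=
  ∀ (j : Fin D.r) (n : ℕ), (D.lam j : ℂ) * s + D.mu j ≠ -(n : ℂ)

/-- The factor of the asymmetric functional equation,
`Δ(s) = ω Q ^ (1 - 2 s) ∏ Γ(λ_j (1 - s) + conj μ_j) / Γ(λ_j s + μ_j)`.
Since `Re μ_j ≥ 0`, the poles of the numerators lie in `Re s ≥ 1` and those of the denominators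
in `Re s ≤ 0`, so no cancellation takes place; at a pole of `Δ` the formula below
has the value `0`, which is immaterial for the solutions of `Δ(s) = a` with `a ≠ 0`. -/
def Delta (s : ℂ) : ℂ :=
  D.omega * (D.Q : ℂ) ^ (1 - 2 * s) *
    ∏ j, (Complex.Gamma (D.lam j * (1 - s) + (starRingEnd ℂ) (D.mu j)) /
      Complex.Gamma (D.lam j * s + D.mu j))

/-- The set of nontrivial `a`-points of `Δ`: solutions of `Δ(s) = a` with `0 ≤ Re s ≤ 1`. -/
def nontrivialPoints (a : ℂ) : Set ℂ :=
  {s | D.Delta s = a ∧ 0 ≤ s.re ∧ s.re ≤ 1}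

/-- The nontrivial `a`-points with ordinate in `(T, T']`. -/
def pointsBetween (a : ℂ) (T T' : ℝ) : Set ℂ :=
  {s | s ∈ D.nontrivialPoints a ∧ T < s.im ∧ s.im ≤ T'}

/-- The multiplicity of `s` as an `a`-point of `Δ`. -/
def multiplicity (a s : ℂ) : ℕ∞ := analyticOrderAt (fun z => D.Delta z - a) s

/-- The sum of `x ^ (i γ_a)` over the nontrivial `a`-points `β_a + i γ_a` with `T < γ_a ≤ T'`,
counted with multiplicity. -/
def ordinateSum (a : ℂ) (x T T' : ℝ) : ℂ :=
  ∑ᶠ s ∈ D.pointsBetween a T T',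
    ((D.multiplicity a s).toNat : ℂ) * (x : ℂ) ^ (Complex.I * (s.im : ℂ))

open Classical in
/-- The sequence `δ` lists the nontrivial `a`-points of `Δ` with positive ordinate, each as often
as its multiplicity says, in the order of increasing ordinates. -/
def IsEnumeration (a : ℂ) (δ : ℕ → ℂ) : Prop :=
  Monotone (fun n => (δ n).im) ∧
  ∀ s : ℂ, {n | δ n = s}.encard =
    if s ∈ D.nontrivialPoints a ∧ 0 < s.im then D.multiplicity a s else 0

end GammaData

/-- An entire function of finite order. -/
def IsEntireOfFiniteOrder (E : ℂ → ℂ) : Prop :=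
  Differentiable ℂ E ∧ ∃ A C : ℝ, ∀ s, ‖E s‖ ≤ C * Real.exp (‖s‖ ^ A)

/-- `L` belongs to the extended Selberg class and satisfies the functional equation with
data `D`. The functional equation is an identity of meromorphic functions; it is stated at the
points where both sides are given by values of holomorphic functions. -/
structure IsExtendedSelberg (L : ℂ → ℂ) (D : GammaData) : Prop where
  dirichlet_series : ∃ f : ℕ → ℂ, ∀ s : ℂ, 1 < s.re →
    LSeriesSummable f s ∧ L s = LSeries f s
  continuation : ∃ (k : ℕ) (E : ℂ → ℂ), IsEntireOfFiniteOrder E ∧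
    ∀ s : ℂ, s ≠ 1 → E s = (s - 1) ^ k * L s
  functional_equation : ∀ s : ℂ, s ≠ 0 → s ≠ 1 →
    D.GammaRegularAt s → D.GammaRegularAt (1 - (starRingEnd ℂ) s) →
    L s * D.gammaFactor s = D.omega *
      (starRingEnd ℂ) (L (1 - (starRingEnd ℂ) s) * D.gammaFactor (1 - (starRingEnd ℂ) s))

/-- The function `ψ(t) = log t / log log t`. -/
def psi (t : ℝ) : ℝ := Real.log t / Real.log (Real.log t)

open Classical in
/-- Uniform distribution modulo one of a sequence of real numbers. -/
def UniformlyDistributedModOne (u : ℕ → ℝ) : Prop :=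
  ∀ b c : ℝ, 0 ≤ b → b ≤ c → c ≤ 1 →
    Tendsto (fun N : ℕ =>
        (((Finset.range N).filter (fun n => Int.fract (u n) ∈ Set.Icc b c)).card : ℝ) / (N : ℝ))
      atTop (𝓝 (c - b))

end SelbergDelta

end

/-! High up in the critical strip Δ = exp(-`phase`) with `phase` holomorphic. Write ℓ(t) =
log(λQ²t^d). Stirling's formula gives `phase'` = ℓ(t) + O(1/t) and `phase''` = -i d/t + O(1/t²). On
a convex half strip Re `phase'` is bounded below by a positive constant, so `phase` is injective
there. The high nontrivial a-points are therefore the solutions of `phase s` = -log|a| + iu with u ≡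
-arg a mod 2π: they sit at equally spaced parameters u on a single curve S(u) along which Re `phase`
is constant.

Along that curve S' = i/`phase'`, so the ordinate Im S has derivative Re(1/`phase'`) ≈ 1/ℓ(t), and
its second derivative is approximately -(d/t)/ℓ(t)³ < 0. The ordinate is thus concave in u: from
some height on the a-points are simple, and their gaps decrease and have size about 2π/ℓ(t).
`exists_isPointSequence` records this, and both parts of the theorem rest on it.

For (i), put X = |log x|. The sum is, up to conjugation, ∑ exp(iXγ_n), whose phase differences
decrease. They are at least X/(2ℓ(T)), and the condition on x keeps them away from 2π, so the
Kusmin-Landau inequality (`norm_sum_exp_le_of_antitone`) gives O(log T/X + yX). If y is so large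
compared with T that the error K/T in the gaps spoils the margin, counting the terms is enough.

For (ii), the gaps decrease to 0 while their reciprocals are o(n), which is what Fejér's criterion
(`uniformlyDistributed_of_antitone_gap`) asks for. Below the first point of the sequence there are
only finitely many a-points with positive ordinate, by the identity theorem for an entire function,
so every listing agrees with the sequence after finitely many terms. -/

namespace SelbergDelta

/-! ### A logarithm of Γ and its derivative -/

/-- The terms of the Weierstrass series of `log Γ`. -/
noncomputable def logGammaTerm (z : ℂ) (j : ℕ) : ℂ :=
  z * (Real.log (1 + 1 / ((j : ℝ) + 1)) : ℂ) - Complex.log (1 + z / ((j : ℂ) + 1))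

/-- A logarithm of `Γ` off the real axis. -/
noncomputable def logGamma (z : ℂ) : ℂ := -Complex.log z + ∑' j, logGammaTerm z j

lemma abs_log_one_add_inv_sub_le (j : ℕ) :
    |Real.log (1 + 1 / ((j : ℝ) + 1)) - 1 / ((j : ℝ) + 1)| ≤ 1 / ((j : ℝ) + 1) ^ 2 := by
  have hj : (0 : ℝ) < (j : ℝ) + 1 := by positivity
  have hx : (0 : ℝ) < 1 / ((j : ℝ) + 1) := by positivity
  have h1 := Real.log_le_sub_one_of_pos (show (0 : ℝ) < 1 + 1 / ((j : ℝ) + 1) by positivity)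
  have h2 := Real.one_sub_inv_le_log_of_pos (show (0 : ℝ) < 1 + 1 / ((j : ℝ) + 1) by positivity)
  have h3 : 1 / ((j : ℝ) + 1) - (1 - (1 + 1 / ((j : ℝ) + 1))⁻¹) ≤ 1 / ((j : ℝ) + 1) ^ 2 := by
    set x := 1 / ((j : ℝ) + 1)
    have : 1 / ((j : ℝ) + 1) ^ 2 = x ^ 2 := by simp [x]
    rw [this]
    have h5 : x - (1 - (1 + x)⁻¹) = x ^ 2 * (1 + x)⁻¹ := by field_simp; ring
    rw [h5]
    have : (1 + x)⁻¹ ≤ 1 := inv_le_one_of_one_le₀ (by linarith)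
    nlinarith [sq_nonneg x]
  rw [abs_le]
  constructor
  · linarith
  · have : 0 < 1 / ((j : ℝ) + 1) ^ 2 := by positivity
    linarith

lemma summable_inv_succ_sq : Summable (fun j : ℕ => 1 / ((j : ℝ) + 1) ^ 2) := by
  have := (summable_nat_add_iff 1).mpr (Real.summable_one_div_nat_pow.mpr one_lt_two)
  simpa using this

/-- Both parts of a term equal z/(j+1) up to O(1/j²), so the first-order contributions cancel. -/
lemma summable_logGammaTerm (z : ℂ) : Summable (logGammaTerm z) := by
  refine Summable.of_norm_bounded_eventually_nat
    (g := fun j : ℕ => (‖z‖ + ‖z‖ ^ 2) * (1 / ((j : ℝ) + 1) ^ 2))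
    (summable_inv_succ_sq.mul_left _) ?_
  obtain ⟨N, hN⟩ := exists_nat_gt (2 * ‖z‖)
  filter_upwards [eventually_ge_atTop N] with j hj
  have hjN : (N : ℝ) ≤ j := by exact_mod_cast hj
  have hj0 : (0 : ℝ) < (j : ℝ) + 1 := by positivity
  have hnorm : ‖z / ((j : ℂ) + 1)‖ = ‖z‖ / ((j : ℝ) + 1) := by
    rw [norm_div]
    congr 1
    have : ((j : ℂ) + 1) = (((j : ℝ) + 1 : ℝ) : ℂ) := by push_cast; rfl
    rw [this, Complex.norm_real, Real.norm_of_nonneg hj0.le]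
  have hle : ‖z / ((j : ℂ) + 1)‖ ≤ 1 / 2 := by
    rw [hnorm, div_le_iff₀ hj0]; linarith
  have h1 := Complex.norm_log_one_add_sub_self_le (lt_of_le_of_lt hle (by norm_num))
  have h2 : ‖z / ((j : ℂ) + 1)‖ ^ 2 * (1 - ‖z / ((j : ℂ) + 1)‖)⁻¹ / 2 ≤
      ‖z / ((j : ℂ) + 1)‖ ^ 2 := by
    have : (1 - ‖z / ((j : ℂ) + 1)‖)⁻¹ ≤ 2 := by
      rw [inv_le_comm₀ (by linarith) (by norm_num)]; linarith
    nlinarith [sq_nonneg ‖z / ((j : ℂ) + 1)‖]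
  have h3 : logGammaTerm z j = z * ((Real.log (1 + 1 / ((j : ℝ) + 1)) - 1 / ((j : ℝ) + 1) : ℝ) : ℂ)
      - (Complex.log (1 + z / ((j : ℂ) + 1)) - z / ((j : ℂ) + 1)) := by
    unfold logGammaTerm
    push_cast
    ring
  rw [h3]
  refine (norm_sub_le _ _).trans ?_
  rw [norm_mul, Complex.norm_real, Real.norm_eq_abs]
  have h4 := mul_le_mul_of_nonneg_left (abs_log_one_add_inv_sub_le j) (norm_nonneg z)
  have h5 : ‖z / ((j : ℂ) + 1)‖ ^ 2 = ‖z‖ ^ 2 * (1 / ((j : ℝ) + 1) ^ 2) := by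
    rw [hnorm, div_pow]; ring
  rw [h5] at h1 h2
  nlinarith [h1.trans h2]

lemma add_natCast_ne_zero {z : ℂ} (hz : z.im ≠ 0) (n : ℕ) : z + n ≠ 0 := by
  intro h
  apply hz
  have := congrArg Complex.im h
  simpa using this

lemma one_add_div_mem_slitPlane {z : ℂ} (hz : z.im ≠ 0) (j : ℕ) :
    1 + z / ((j : ℂ) + 1) ∈ Complex.slitPlane := by
  right
  have : ((j : ℂ) + 1) = (((j : ℝ) + 1 : ℝ) : ℂ) := by push_cast; rfl
  rw [this, Complex.add_im, Complex.div_ofReal_im]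
  have : (j : ℝ) + 1 ≠ 0 := by positivity
  simp [hz, this]

lemma sum_log_one_add_inv (n : ℕ) :
    ∑ j ∈ Finset.range n, Real.log (1 + 1 / ((j : ℝ) + 1)) = Real.log ((n : ℝ) + 1) := by
  induction n with
  | zero => simp
  | succ n ih =>
    rw [Finset.sum_range_succ, ih, ← Real.log_mul (by positivity) (by positivity)]
    congr 1
    push_cast
    field_simp

lemma prod_one_add_div {z : ℂ} (n : ℕ) :
    (∏ j ∈ Finset.range n, (1 + z / ((j : ℂ) + 1))) * (n.factorial : ℂ) =
      ∏ j ∈ Finset.range n, (z + ((j : ℂ) + 1)) := by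
  induction n with
  | zero => simp
  | succ n ih =>
    rw [Finset.prod_range_succ, Finset.prod_range_succ, ← ih, Nat.factorial_succ]
    have : (n : ℂ) + 1 ≠ 0 := by exact_mod_cast Nat.succ_ne_zero n
    push_cast
    field_simp
    ring

/-- The exponential of a partial sum is Euler's product `GammaSeq z n` times exp(z log(1 + 1/n)):
the logarithms telescope to log(n + 1) where Euler's product has log n. The extra factor tends to 1.
-/
lemma exp_logGamma {z : ℂ} (hz : z.im ≠ 0) : Complex.exp (logGamma z) = Complex.Gamma z := by
  have hz0 : z ≠ 0 := by rintro rfl; simp at hz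
  have hsum := (summable_logGammaTerm z).hasSum.tendsto_sum_nat
  have h1 : Tendsto (fun n => Complex.exp (-Complex.log z +
      ∑ j ∈ Finset.range n, logGammaTerm z j)) atTop (𝓝 (Complex.exp (logGamma z))) :=
    (Complex.continuous_exp.tendsto _).comp (hsum.const_add _)
  have h2 : ∀ n : ℕ, n ≠ 0 → Complex.exp (-Complex.log z +
      ∑ j ∈ Finset.range n, logGammaTerm z j) = Complex.GammaSeq z n *
        Complex.exp (z * ((Real.log (1 + 1 / (n : ℝ)) : ℝ) : ℂ)) := by
    intro n hn
    have hn0 : (n : ℝ) ≠ 0 := by exact_mod_cast hn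
    have hnp : (0 : ℝ) < n := by positivity
    have hlogs : Complex.exp (∑ j ∈ Finset.range n, Complex.log (1 + z / ((j : ℂ) + 1))) =
        ∏ j ∈ Finset.range n, (1 + z / ((j : ℂ) + 1)) := by
      rw [Complex.exp_sum]
      refine Finset.prod_congr rfl fun j _ => Complex.exp_log ?_
      exact Complex.slitPlane_ne_zero (one_add_div_mem_slitPlane hz j)
    have hsplit : ∑ j ∈ Finset.range n, logGammaTerm z j = z * ((Real.log ((n : ℝ) + 1) : ℝ) : ℂ) -
        ∑ j ∈ Finset.range n, Complex.log (1 + z / ((j : ℂ) + 1)) := by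
      unfold logGammaTerm
      rw [Finset.sum_sub_distrib, ← Finset.mul_sum, ← sum_log_one_add_inv]
      push_cast
      rfl
    have hlogn : Real.log ((n : ℝ) + 1) = Real.log n + Real.log (1 + 1 / (n : ℝ)) := by
      rw [← Real.log_mul hn0 (by positivity)]
      congr 1
      field_simp
    have hfac : (n.factorial : ℂ) ≠ 0 := by exact_mod_cast n.factorial_ne_zero
    have hprod0 : ∏ j ∈ Finset.range n, (1 + z / ((j : ℂ) + 1)) ≠ 0 :=
      Finset.prod_ne_zero_iff.mpr fun j _ =>
        Complex.slitPlane_ne_zero (one_add_div_mem_slitPlane hz j)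
    have hGS : Complex.GammaSeq z n = Complex.exp (z * ((Real.log n : ℝ) : ℂ)) /
        (z * ∏ j ∈ Finset.range n, (1 + z / ((j : ℂ) + 1))) := by
      unfold Complex.GammaSeq
      rw [Finset.prod_range_succ', Complex.cpow_def_of_ne_zero (by exact_mod_cast hn)]
      have : ∏ k ∈ Finset.range n, (z + ((k + 1 : ℕ) : ℂ)) =
        (∏ j ∈ Finset.range n, (1 + z / ((j : ℂ) + 1))) * (n.factorial : ℂ) := by
        rw [prod_one_add_div]
        simp
      rw [this, ← Complex.natCast_log, mul_comm z]
      simp only [Nat.cast_zero, add_zero]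
      field_simp
    rw [hsplit, Complex.exp_add, Complex.exp_sub, hlogs, Complex.exp_neg, Complex.exp_log hz0, hlogn,
      hGS]
    push_cast
    rw [mul_add, Complex.exp_add]
    field_simp
  have h3 : Tendsto (fun n : ℕ => Complex.GammaSeq z n *
        Complex.exp (z * ((Real.log (1 + 1 / (n : ℝ)) : ℝ) : ℂ))) atTop
        (𝓝 (Complex.Gamma z * Complex.exp (z * ((Real.log (1 + 0) : ℝ) : ℂ)))) := by
    refine (Complex.GammaSeq_tendsto_Gamma z).mul ?_
    refine (Complex.continuous_exp.tendsto _).comp (Tendsto.const_mul _ ?_)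
    refine (Complex.continuous_ofReal.tendsto _).comp ?_
    refine Tendsto.log ?_ (by norm_num)
    exact tendsto_one_div_atTop_nhds_zero_nat.const_add 1
  refine tendsto_nhds_unique h1 ((h3.congr' ?_).trans (by simp))
  filter_upwards [eventually_ne_atTop 0] with n hn
  exact (h2 n hn).symm

/-- A lower bound for |w + j + 1|, linear in j and uniform for bounded w off the real axis; it
dominates the differentiated series. -/
lemma norm_add_natCast_le {w : ℂ} {R : ℝ} (hw : 1 ≤ |w.im|) (hR : ‖w‖ ≤ R) (j : ℕ) :
    (j : ℝ) + 1 ≤ (1 + R) * ‖w + ((j : ℂ) + 1)‖ := by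
  have h1 : 1 ≤ ‖w + ((j : ℂ) + 1)‖ := by
    refine hw.trans ?_
    have := Complex.abs_im_le_norm (w + ((j : ℂ) + 1))
    simpa using this
  have h2 : (j : ℝ) + 1 ≤ ‖w + ((j : ℂ) + 1)‖ + ‖w‖ := by
    have h3 := norm_sub_le (w + ((j : ℂ) + 1)) w
    have h4 : w + ((j : ℂ) + 1) - w = (((j : ℝ) + 1 : ℝ) : ℂ) := by push_cast; ring
    rw [h4, Complex.norm_real, Real.norm_of_nonneg (by positivity)] at h3
    exact h3
  have : 0 ≤ ‖w‖ := norm_nonneg w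
  nlinarith

/-- The derivative of `logGamma`, as a series. -/
lemma hasDerivAt_logGamma {z : ℂ} (hz : 2 ≤ |z.im|) :
    HasDerivAt logGamma (-z⁻¹ + ∑' j : ℕ, (((Real.log (1 + 1 / ((j : ℝ) + 1)) : ℝ) : ℂ) -
      1 / (z + ((j : ℂ) + 1)))) z ∧
    Summable (fun j : ℕ => (((Real.log (1 + 1 / ((j : ℝ) + 1)) : ℝ) : ℂ) -
      1 / (z + ((j : ℂ) + 1)))) := by
  set R := ‖z‖ + 1 with hR
  have hball : ∀ w ∈ Metric.ball z 1, 1 ≤ |w.im| ∧ ‖w‖ ≤ R := by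
    intro w hw
    rw [Metric.mem_ball, dist_eq_norm] at hw
    constructor
    · have h1 := Complex.abs_im_le_norm (w - z)
      have h2 := abs_sub_abs_le_abs_sub z.im w.im
      rw [Complex.sub_im, abs_sub_comm] at h1
      linarith
    · have := norm_le_norm_add_norm_sub' w z
      linarith
  -- A summable majorant, uniform on the unit disc about z, so that the series may be differentiated
  -- term by term.
  have hbound : ∀ (j : ℕ), ∀ w ∈ Metric.ball z 1,
      ‖(((Real.log (1 + 1 / ((j : ℝ) + 1)) : ℝ) : ℂ) - 1 / (w + ((j : ℂ) + 1)))‖ ≤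
        (1 + R * (1 + R)) * (1 / ((j : ℝ) + 1) ^ 2) := by
    intro j w hw
    obtain ⟨h1, h2⟩ := hball w hw
    have h3 := norm_add_natCast_le h1 h2 j
    have hj0 : (0 : ℝ) < (j : ℝ) + 1 := by positivity
    have hjc : (j : ℂ) + 1 ≠ 0 := by exact_mod_cast Nat.succ_ne_zero j
    have hR0 : 0 ≤ R := by positivity
    have hw0 : 0 < ‖w + ((j : ℂ) + 1)‖ := by
      by_contra h
      nlinarith
    have hw0' : w + ((j : ℂ) + 1) ≠ 0 := norm_pos_iff.mp hw0
    have h4 : (((Real.log (1 + 1 / ((j : ℝ) + 1)) : ℝ) : ℂ) - 1 / (w + ((j : ℂ) + 1))) =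
      ((Real.log (1 + 1 / ((j : ℝ) + 1)) - 1 / ((j : ℝ) + 1) : ℝ) : ℂ) +
        w / (((j : ℂ) + 1) * (w + ((j : ℂ) + 1))) := by
      push_cast
      field_simp
      ring
    rw [h4]
    refine (norm_add_le _ _).trans ?_
    rw [Complex.norm_real, Real.norm_eq_abs, norm_div, norm_mul]
    have h5 := abs_log_one_add_inv_sub_le j
    have h6 : ‖(j : ℂ) + 1‖ = (j : ℝ) + 1 := by
      have : ((j : ℂ) + 1) = (((j : ℝ) + 1 : ℝ) : ℂ) := by push_cast; rfl
      rw [this, Complex.norm_real, Real.norm_of_nonneg hj0.le]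
    rw [h6]
    have h7 : ‖w‖ / (((j : ℝ) + 1) * ‖w + ((j : ℂ) + 1)‖) ≤ R * (1 + R) * (1 / ((j : ℝ) + 1) ^ 2) := by
      rw [div_le_iff₀ (by positivity)]
      have h8 : R * (1 + R) * (1 / ((j : ℝ) + 1) ^ 2) * (((j : ℝ) + 1) * ‖w + ((j : ℂ) + 1)‖) =
        R * (((1 + R) * ‖w + ((j : ℂ) + 1)‖) / ((j : ℝ) + 1)) := by field_simp
      rw [h8]
      have h9 : 1 ≤ ((1 + R) * ‖w + ((j : ℂ) + 1)‖) / ((j : ℝ) + 1) := by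
        rw [le_div_iff₀ hj0]; linarith
      nlinarith
    linarith
  have hsm : Summable (fun j : ℕ => (1 + R * (1 + R)) * (1 / ((j : ℝ) + 1) ^ 2)) :=
    summable_inv_succ_sq.mul_left _
  have hmem : z ∈ Metric.ball z 1 := Metric.mem_ball_self one_pos
  refine ⟨?_, Summable.of_norm_bounded hsm fun j => hbound j z hmem⟩
  have hz0 : z ∈ Complex.slitPlane := by
    right; intro h; rw [h] at hz; norm_num at hz
  refine (Complex.hasDerivAt_log hz0).neg.add ?_
  refine hasDerivAt_tsum_of_isPreconnected hsm Metric.isOpen_ball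
    (convex_ball z 1).isPreconnected ?_ hbound hmem (summable_logGammaTerm z) hmem
  intro j w hw
  have him : w.im ≠ 0 := by
    intro h; have := (hball w hw).1; rw [h] at this; norm_num at this
  have hjc : (j : ℂ) + 1 ≠ 0 := by exact_mod_cast Nat.succ_ne_zero j
  have hd : HasDerivAt (fun w : ℂ => 1 + w / ((j : ℂ) + 1)) (1 / ((j : ℂ) + 1)) w :=
    ((hasDerivAt_id w).div_const _).const_add 1
  have hslit := one_add_div_mem_slitPlane him j
  have h1 := ((hasDerivAt_id w).mul_const ((Real.log (1 + 1 / ((j : ℝ) + 1)) : ℝ) : ℂ)).sub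
    (hd.clog hslit)
  refine h1.congr_deriv ?_
  have h2 := Complex.slitPlane_ne_zero hslit
  have h3 : w + ((j : ℂ) + 1) ≠ 0 := by
    have := add_natCast_ne_zero him (j + 1)
    push_cast at this
    exact this
  have h4 : 1 + w / ((j : ℂ) + 1) = (w + ((j : ℂ) + 1)) / ((j : ℂ) + 1) := by
    field_simp
    ring
  rw [h4, one_mul]
  congr 1
  field_simp

/-! ### Stirling's formula for the first two derivatives -/

/-- The imaginary parts of w and 1 + 1/w have opposite signs, so the sum of the two arguments stays
in (-π, π] and no multiple of 2πi appears. -/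
lemma log_add_one_sub_log {w : ℂ} (hw : w.im ≠ 0) :
    Complex.log (w + 1) - Complex.log w = Complex.log (1 + 1 / w) := by
  have hw0 : w ≠ 0 := by rintro rfl; simp at hw
  have hmul : w * (1 + 1 / w) = w + 1 := by field_simp
  have h1 : 1 + 1 / w ≠ 0 := by
    intro h
    rw [h, mul_zero] at hmul
    apply hw
    have := congrArg Complex.im hmul
    simpa using this.symm
  have him : (1 + 1 / w).im = -w.im / Complex.normSq w := by
    simp [Complex.inv_im]
  have hn : 0 < Complex.normSq w := Complex.normSq_pos.mpr hw0
  rw [← hmul, Complex.log_mul_eq_add_log_iff hw0 h1 |>.mpr]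
  · ring
  · rcases lt_or_gt_of_ne hw with h | h
    · have a1 := Complex.arg_neg_iff.mpr h
      have a2 := Complex.neg_pi_lt_arg w
      have a3 : 0 ≤ (1 + 1 / w).arg := by
        rw [Complex.arg_nonneg_iff, him]; exact div_nonneg (by linarith) hn.le
      have a4 := Complex.arg_le_pi (1 + 1 / w)
      constructor <;> linarith
    · have a1 : 0 ≤ w.arg := Complex.arg_nonneg_iff.mpr h.le
      have a2 := Complex.arg_le_pi w
      have a3 : (1 + 1 / w).arg < 0 := by
        rw [Complex.arg_neg_iff, him]; exact div_neg_of_neg_of_pos (by linarith) hn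
      have a4 := Complex.neg_pi_lt_arg (1 + 1 / w)
      constructor <;> linarith

/-- The difference is at most |z + n|⁻². The condition on Re z gives 3|z + n| ≥ |Im z| + n, and 1/Y²
≤ 1/(Y - 1) - 1/Y makes the bound telescope in n. -/
lemma norm_log_sub_log_sub_inv_le {z : ℂ} (hz : 2 ≤ |z.im|) (hre : -|z.im| ≤ z.re) (n : ℕ) :
    ‖Complex.log (z + n + 1) - Complex.log (z + n) - 1 / (z + n)‖ ≤
      9 * (1 / (|z.im| + n - 1) - 1 / (|z.im| + (n + 1 : ℕ) - 1)) := by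
  have him : (z + n).im = z.im := by simp
  have hne : (z + n).im ≠ 0 := by
    rw [him]; intro h; rw [h] at hz; norm_num at hz
  have hm : |z.im| ≤ ‖z + n‖ := by rw [← him]; exact Complex.abs_im_le_norm _
  have hm2 : (n : ℝ) + |z.im| ≤ 3 * ‖z + n‖ := by
    have := Complex.re_le_norm (z + n)
    simp at this
    linarith
  have hm0 : 2 ≤ ‖z + n‖ := hz.trans hm
  rw [log_add_one_sub_log hne]
  have hlt : ‖1 / (z + n)‖ ≤ 1 / 2 := by
    rw [norm_div, norm_one]
    exact one_div_le_one_div_of_le (by norm_num) hm0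
  have h1 := Complex.norm_log_one_add_sub_self_le (lt_of_le_of_lt hlt (by norm_num))
  have h2 : (1 - ‖1 / (z + n)‖)⁻¹ ≤ 2 := by
    rw [inv_le_comm₀ (by linarith) (by norm_num)]; linarith
  have h3 : ‖1 / (z + n)‖ ^ 2 * (1 - ‖1 / (z + n)‖)⁻¹ / 2 ≤ ‖1 / (z + n)‖ ^ 2 := by
    nlinarith [sq_nonneg ‖1 / (z + n)‖]
  refine (h1.trans h3).trans ?_
  set Y := |z.im| + n with hY
  have hY2 : 2 ≤ Y := by have : (0 : ℝ) ≤ n := n.cast_nonneg; linarith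
  have h4 : |z.im| + ((n + 1 : ℕ) : ℝ) - 1 = Y := by push_cast; ring
  rw [h4, norm_div, norm_one, one_div, inv_pow]
  have h5 : Y ^ 2 ≤ 9 * ‖z + n‖ ^ 2 := by nlinarith
  have h6 : (‖z + n‖ ^ 2)⁻¹ ≤ 9 / Y ^ 2 := by
    rw [inv_le_comm₀ (by positivity) (by positivity), inv_div]
    linarith [div_le_iff₀ (show (0 : ℝ) < 9 by norm_num) |>.mpr (by linarith : Y ^ 2 ≤ ‖z + n‖ ^ 2 * 9)]
  refine h6.trans ?_
  have h7 : 9 * (1 / (Y - 1) - 1 / Y) = 9 / ((Y - 1) * Y) := by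
    have : Y - 1 ≠ 0 := by linarith
    have : Y ≠ 0 := by linarith
    field_simp
    ring
  rw [h7]
  exact div_le_div_of_nonneg_left (by norm_num) (by nlinarith) (by nlinarith)

/-- Stirling's formula for the logarithmic derivative of `Γ`. -/
lemma norm_deriv_logGamma_sub_log_le {z : ℂ} (hz : 2 ≤ |z.im|) (hre : -|z.im| ≤ z.re) :
    ‖deriv logGamma z - Complex.log z‖ ≤ 18 / |z.im| := by
  obtain ⟨hd, hs⟩ := hasDerivAt_logGamma hz
  have hne : z.im ≠ 0 := by intro h; rw [h] at hz; norm_num at hz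
  rw [hd.deriv]
  have htend := hs.hasSum.tendsto_sum_nat
  -- Telescoping the logarithms turns the partial sums of Γ'/Γ minus log z into a sum of the small
  -- terms just estimated, up to log(1 + z/(N + 1)), which tends to 0.
  have hident : ∀ N : ℕ, ∑ n ∈ Finset.range (N + 1),
      (Complex.log (z + n + 1) - Complex.log (z + n) - 1 / (z + n)) =
      (-z⁻¹ + ∑ j ∈ Finset.range N, (((Real.log (1 + 1 / ((j : ℝ) + 1)) : ℝ) : ℂ) -
      1 / (z + ((j : ℂ) + 1)))) - Complex.log z + Complex.log (1 + z / ((N : ℂ) + 1)) := by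
    intro N
    have h1 : ∑ n ∈ Finset.range (N + 1), (Complex.log (z + n + 1) - Complex.log (z + n)) =
        Complex.log (z + ((N : ℂ) + 1)) - Complex.log z := by
      have := Finset.sum_range_sub (fun n : ℕ => Complex.log (z + n)) (N + 1)
      simpa [add_assoc] using this
    have h2 : Complex.log (z + ((N : ℂ) + 1)) = ((Real.log ((N : ℝ) + 1) : ℝ) : ℂ) +
        Complex.log (1 + z / ((N : ℂ) + 1)) := by
      have hN : (N : ℂ) + 1 ≠ 0 := by exact_mod_cast Nat.succ_ne_zero N
      rw [← Complex.log_ofReal_mul (by positivity)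
        (Complex.slitPlane_ne_zero (one_add_div_mem_slitPlane hne N))]
      congr 1
      push_cast
      field_simp
      ring
    have h3 : ∑ n ∈ Finset.range (N + 1), 1 / (z + n) =
        ∑ j ∈ Finset.range N, 1 / (z + ((j : ℂ) + 1)) + z⁻¹ := by
      rw [Finset.sum_range_succ']
      simp
    rw [Finset.sum_sub_distrib, h1, h3, h2, Finset.sum_sub_distrib]
    have h4 := sum_log_one_add_inv N
    rw [← h4]
    push_cast
    ring
  have hlim : Tendsto (fun N : ℕ => ∑ n ∈ Finset.range (N + 1),
      (Complex.log (z + n + 1) - Complex.log (z + n) - 1 / (z + n))) atTop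
      (𝓝 ((-z⁻¹ + ∑' j : ℕ, (((Real.log (1 + 1 / ((j : ℝ) + 1)) : ℝ) : ℂ) -
      1 / (z + ((j : ℂ) + 1)))) - Complex.log z + Complex.log (1 + z * 0))) := by
    simp_rw [hident]
    refine ((htend.const_add _).sub_const _).add ?_
    refine Tendsto.clog ?_ (by simp)
    refine Tendsto.const_add _ ?_
    simp_rw [div_eq_mul_inv]
    refine Tendsto.const_mul _ ?_
    have := tendsto_one_div_add_atTop_nhds_zero_nat (𝕜 := ℂ)
    simpa using this
  simp only [mul_zero, add_zero, Complex.log_one] at hlim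
  refine le_of_tendsto hlim.norm (Eventually.of_forall fun N => ?_)
  refine (norm_sum_le _ _).trans ((Finset.sum_le_sum fun n _ =>
    norm_log_sub_log_sub_inv_le hz hre n).trans ?_)
  rw [← Finset.mul_sum, Finset.sum_range_sub' (fun n : ℕ => 1 / (|z.im| + (n : ℝ) - 1))]
  have h5 : (0 : ℝ) ≤ 1 / (|z.im| + ((N + 1 : ℕ) : ℝ) - 1) := by
    have : (0 : ℝ) ≤ N := N.cast_nonneg
    push_cast
    apply div_nonneg <;> linarith
  have h6 : 1 / (|z.im| + ((0 : ℕ) : ℝ) - 1) ≤ 2 / |z.im| := by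
    rw [Nat.cast_zero, add_zero, div_le_div_iff₀ (by linarith) (by linarith)]
    linarith
  have h7 : 18 / |z.im| = 9 * (2 / |z.im|) := by ring
  rw [h7]
  linarith

lemma differentiableAt_deriv_logGamma {z : ℂ} (hz : 2 < |z.im|) :
    DifferentiableAt ℂ (deriv logGamma) z := by
  have hopen : IsOpen {w : ℂ | 2 < |w.im|} :=
    isOpen_lt continuous_const (continuous_abs.comp Complex.continuous_im)
  have hd : DifferentiableOn ℂ logGamma {w : ℂ | 2 < |w.im|} := fun w hw =>
    (hasDerivAt_logGamma (le_of_lt hw)).1.differentiableAt.differentiableWithinAt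
  exact (hd.deriv hopen).differentiableAt (hopen.mem_nhds hz)

/-- Cauchy's estimate on the disc of radius |Im z|/4. There |Im w| ≥ 3|Im z|/4, so the first-order
error is at most 24/|Im z|; dividing by the radius gives 96/|Im z|². -/
lemma norm_deriv_deriv_logGamma_sub_inv_le {z : ℂ} (hz : 4 ≤ |z.im|) (hre : -(|z.im| / 4) ≤ z.re) :
    ‖deriv (deriv logGamma) z - z⁻¹‖ ≤ 96 / |z.im| ^ 2 := by
  set y := |z.im| with hy
  have hball : ∀ w ∈ Metric.closedBall z (y / 4), 3 / 4 * y ≤ |w.im| ∧ -|w.im| ≤ w.re := by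
    intro w hw
    rw [Metric.mem_closedBall, dist_eq_norm] at hw
    have h1 := (Complex.abs_im_le_norm (w - z)).trans hw
    have h2 := abs_sub_abs_le_abs_sub z.im w.im
    rw [Complex.sub_im, abs_sub_comm] at h1
    have h3 := (Complex.abs_re_le_norm (w - z)).trans hw
    rw [Complex.sub_re, abs_le] at h3
    constructor <;> linarith
  have hslit : ∀ w : ℂ, 2 < |w.im| → w ∈ Complex.slitPlane := by
    intro w hw; right; intro h; rw [h] at hw; norm_num at hw
  have hdiff : ∀ w : ℂ, 2 < |w.im| →
      DifferentiableAt ℂ (fun w => deriv logGamma w - Complex.log w) w := fun w hw =>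
    (differentiableAt_deriv_logGamma hw).sub (Complex.differentiableAt_log (hslit w hw))
  have hderiv : deriv (fun w => deriv logGamma w - Complex.log w) z =
      deriv (deriv logGamma) z - z⁻¹ := by
    have h := ((differentiableAt_deriv_logGamma (by linarith : 2 < |z.im|)).hasDerivAt.sub
      (Complex.hasDerivAt_log (hslit z (by linarith : 2 < |z.im|))))
    exact h.deriv
  rw [← hderiv]
  have hdc : DiffContOnCl ℂ (fun w => deriv logGamma w - Complex.log w) (Metric.ball z (y / 4)) := by
    apply DifferentiableOn.diffContOnCl
    rw [closure_ball _ (by positivity)]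
    intro w hw
    exact (hdiff w (by have := (hball w hw).1; linarith)).differentiableWithinAt
  have hR : 0 < y / 4 := by linarith
  refine (Complex.norm_deriv_le_of_forall_mem_sphere_norm_le hR hdc (C := 24 / y) ?_).trans ?_
  · intro w hw
    obtain ⟨h1, h2⟩ := hball w (Metric.sphere_subset_closedBall hw)
    refine (norm_deriv_logGamma_sub_log_le (by linarith) h2).trans ?_
    rw [div_le_div_iff₀ (by linarith) (by linarith)]
    linarith
  · apply le_of_eq
    field_simp
    norm_num

/-! ### Asymptotics in the strip -/

/-- The filter of points of the strip `-1 < Re s < 2` with imaginary part tending to `+∞`. -/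
def stripTop : Filter ℂ := comap Complex.im atTop ⊓ 𝓟 {s : ℂ | -1 < s.re ∧ s.re < 2}

lemma eventually_stripTop {p : ℂ → Prop} :
    (∀ᶠ s in stripTop, p s) ↔ ∃ t₀ : ℝ, ∀ s : ℂ, -1 < s.re → s.re < 2 → t₀ ≤ s.im → p s := by
  rw [stripTop, eventually_inf_principal, eventually_comap, eventually_atTop]
  constructor
  · rintro ⟨t₀, h⟩
    exact ⟨t₀, fun s h1 h2 h3 => h s.im h3 s rfl ⟨h1, h2⟩⟩
  · rintro ⟨t₀, h⟩
    exact ⟨t₀, fun t ht s hs h12 => h s h12.1 h12.2 (by rw [hs]; exact ht)⟩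

lemma tendsto_im_stripTop : Tendsto Complex.im stripTop atTop :=
  tendsto_comap.mono_left inf_le_left

lemma isBigO_re_stripTop : (fun s : ℂ => (s.re : ℂ)) =O[stripTop] (fun _ => (1 : ℝ)) := by
  refine Asymptotics.IsBigO.of_bound 2 ?_
  rw [eventually_stripTop]
  refine ⟨0, fun s h1 h2 _ => ?_⟩
  rw [Complex.norm_real, Real.norm_eq_abs, norm_one, mul_one, abs_le]
  constructor <;> linarith

-- Both kinds of Γ-arguments have the form λt·c + b(s), with t = Im s, c = ±i and b bounded on the
-- strip, so they are treated together.
section RotatedArgument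

variable {lam : ℝ} {c : ℂ} {b : ℂ → ℂ}

lemma isBigO_shift (hlam : 0 < lam) (hb : b =O[stripTop] (fun _ => (1 : ℝ))) :
    (fun s => b s / ((lam * s.im : ℝ) : ℂ)) =O[stripTop] (fun s => (s.im)⁻¹) := by
  have h : (fun s : ℂ => (((lam * s.im : ℝ) : ℂ))⁻¹) =O[stripTop] (fun s : ℂ => (s.im)⁻¹) := by
    refine Asymptotics.IsBigO.of_bound lam⁻¹ (Eventually.of_forall fun s => ?_)
    rw [norm_inv, Complex.norm_real, norm_mul, mul_inv, norm_inv, Real.norm_of_nonneg hlam.le]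
  simpa [div_eq_mul_inv] using hb.mul h

lemma tendsto_shift (hlam : 0 < lam) (hb : b =O[stripTop] (fun _ => (1 : ℝ))) (c : ℂ) :
    Tendsto (fun s => c + b s / ((lam * s.im : ℝ) : ℂ)) stripTop (𝓝 c) := by
  have h := (isBigO_shift hlam hb).trans_tendsto
    (tendsto_inv_atTop_zero.comp tendsto_im_stripTop)
  simpa using h.const_add c

lemma shift_eq (hlam : 0 < lam) : ∀ᶠ s in stripTop, (lam * s.im : ℝ) * c + b s =
    ((lam * s.im : ℝ) : ℂ) * (c + b s / ((lam * s.im : ℝ) : ℂ)) := by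
  filter_upwards [tendsto_im_stripTop.eventually_gt_atTop 0] with s hs
  have : ((lam * s.im : ℝ) : ℂ) ≠ 0 := by exact_mod_cast (mul_pos hlam hs).ne'
  field_simp

/-- The positive factor λt splits off the principal logarithm exactly; the rest is the logarithm
near c, differentiable because c is off the real axis. -/
lemma isBigO_log_shift (hlam : 0 < lam) (hc : c.im ≠ 0) (hb : b =O[stripTop] (fun _ => (1 : ℝ))) :
    (fun s => Complex.log ((lam * s.im : ℝ) * c + b s) -
      (((Real.log lam + Real.log s.im : ℝ) : ℂ) + Complex.log c)) =O[stripTop]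
      (fun s => (s.im)⁻¹) := by
  have hslit : c ∈ Complex.slitPlane := Or.inr hc
  have h1 := (Complex.hasDerivAt_log hslit).isBigO_sub.comp_tendsto (tendsto_shift hlam hb c)
  have h2 : (fun s => c + b s / ((lam * s.im : ℝ) : ℂ) - c) =O[stripTop] (fun s => (s.im)⁻¹) := by
    simpa using isBigO_shift hlam hb
  refine (h1.trans h2).congr' ?_ EventuallyEq.rfl
  have hne : ∀ᶠ s in stripTop, c + b s / ((lam * s.im : ℝ) : ℂ) ≠ 0 :=
    (tendsto_shift hlam hb c).eventually_ne (Complex.slitPlane_ne_zero hslit)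
  filter_upwards [shift_eq (c := c) (b := b) hlam, hne,
    tendsto_im_stripTop.eventually_gt_atTop 0] with s h3 h4 h5
  rw [h3, Complex.log_ofReal_mul (mul_pos hlam h5) h4, Real.log_mul hlam.ne' h5.ne']
  simp only [Function.comp]
  ring

lemma isBigO_inv_shift (hlam : 0 < lam) (hc : c.im ≠ 0) (hb : b =O[stripTop] (fun _ => (1 : ℝ))) :
    (fun s => ((lam * s.im : ℝ) * c + b s)⁻¹ - ((lam * s.im : ℝ) * c)⁻¹) =O[stripTop]
      (fun s => (s.im ^ 2)⁻¹) := by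
  have hc0 : c ≠ 0 := by rintro rfl; simp at hc
  have h1 := (hasDerivAt_inv hc0).isBigO_sub.comp_tendsto (tendsto_shift hlam hb c)
  have h2 : (fun s => c + b s / ((lam * s.im : ℝ) : ℂ) - c) =O[stripTop] (fun s => (s.im)⁻¹) := by
    simpa using isBigO_shift hlam hb
  have h3 : (fun s : ℂ => 1 / ((lam * s.im : ℝ) : ℂ)) =O[stripTop] (fun s => (s.im)⁻¹) :=
    isBigO_shift (b := fun _ => 1) hlam (Asymptotics.isBigO_of_le _ (by simp))
  refine (h3.mul (h1.trans h2)).congr' ?_ ?_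
  · filter_upwards [shift_eq (c := c) (b := b) hlam] with s h4
    rw [h4, mul_inv, mul_inv]
    simp only [Function.comp]
    ring
  · filter_upwards with s
    rw [sq, mul_inv]

lemma eventually_im_shift (hlam : 0 < lam) (hc : |c.im| = 1) (hc' : c.re = 0)
    (hb : b =O[stripTop] (fun _ => (1 : ℝ))) :
    ∀ᶠ s in stripTop, 4 ≤ |((lam * s.im : ℝ) * c + b s).im| ∧
      -(|((lam * s.im : ℝ) * c + b s).im| / 4) ≤ ((lam * s.im : ℝ) * c + b s).re ∧
      lam / 2 * s.im ≤ |((lam * s.im : ℝ) * c + b s).im| ∧ 0 < s.im := by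
  obtain ⟨B, hB⟩ := hb.bound
  filter_upwards [hB, tendsto_im_stripTop.eventually_gt_atTop 0,
    tendsto_im_stripTop.eventually_ge_atTop (2 / lam * (4 + 4 * |B|))] with s h1 h2 h3
  rw [norm_one, mul_one] at h1
  have h4 := (Complex.abs_im_le_norm (b s)).trans (h1.trans (le_abs_self B))
  have h5 := (Complex.abs_re_le_norm (b s)).trans (h1.trans (le_abs_self B))
  have h6 : lam / 2 * s.im ≥ 4 + 4 * |B| := by
    have := mul_le_mul_of_nonneg_left h3 (by positivity : 0 ≤ lam / 2)
    have h7 : lam / 2 * (2 / lam * (4 + 4 * |B|)) = 4 + 4 * |B| := by field_simp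
    linarith
  have h8 : lam * s.im - |B| ≤ |((lam * s.im : ℝ) * c + b s).im| := by
    have e : ((lam * s.im : ℝ) * c + b s).im = lam * s.im * c.im + (b s).im := by simp
    rw [e]
    have h9 : |lam * s.im * c.im| = lam * s.im := by
      rw [abs_mul, hc, mul_one, abs_of_pos (mul_pos hlam h2)]
    have := abs_sub_abs_le_abs_sub (lam * s.im * c.im) (-(b s).im)
    rw [sub_neg_eq_add, abs_neg, h9] at this
    linarith
  have h10 : ((lam * s.im : ℝ) * c + b s).re = (b s).re := by simp [hc']
  rw [abs_le] at h5
  have : 0 ≤ |B| := abs_nonneg B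
  refine ⟨by linarith, ?_, by linarith, h2⟩
  rw [h10]
  linarith

lemma isBigO_deriv_logGamma (hlam : 0 < lam) (hc : |c.im| = 1) (hc' : c.re = 0)
    (hb : b =O[stripTop] (fun _ => (1 : ℝ))) :
    (fun s => deriv logGamma ((lam * s.im : ℝ) * c + b s) -
      (((Real.log lam + Real.log s.im : ℝ) : ℂ) + Complex.log c)) =O[stripTop]
      (fun s => (s.im)⁻¹) := by
  have hc0 : c.im ≠ 0 := by intro h; simp [h] at hc
  have h1 : (fun s => deriv logGamma ((lam * s.im : ℝ) * c + b s) -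
      Complex.log ((lam * s.im : ℝ) * c + b s)) =O[stripTop] (fun s => (s.im)⁻¹) := by
    refine Asymptotics.IsBigO.of_bound (36 / lam) ?_
    filter_upwards [eventually_im_shift hlam hc hc' hb] with s ⟨h2, h3, h4, h5⟩
    refine (norm_deriv_logGamma_sub_log_le (by linarith) (by linarith)).trans ?_
    rw [norm_inv, Real.norm_of_nonneg h5.le]
    refine (div_le_div_of_nonneg_left (by norm_num) (by positivity) h4).trans (le_of_eq ?_)
    field_simp
    norm_num
  simpa using h1.add (isBigO_log_shift hlam hc0 hb)

lemma isBigO_deriv_deriv_logGamma (hlam : 0 < lam) (hc : |c.im| = 1) (hc' : c.re = 0)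
    (hb : b =O[stripTop] (fun _ => (1 : ℝ))) :
    (fun s => deriv (deriv logGamma) ((lam * s.im : ℝ) * c + b s) -
      ((lam * s.im : ℝ) * c)⁻¹) =O[stripTop] (fun s => (s.im ^ 2)⁻¹) := by
  have hc0 : c.im ≠ 0 := by intro h; simp [h] at hc
  have h1 : (fun s => deriv (deriv logGamma) ((lam * s.im : ℝ) * c + b s) -
      ((lam * s.im : ℝ) * c + b s)⁻¹) =O[stripTop] (fun s => (s.im ^ 2)⁻¹) := by
    refine Asymptotics.IsBigO.of_bound (96 * 4 / lam ^ 2) ?_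
    filter_upwards [eventually_im_shift hlam hc hc' hb] with s ⟨h2, h3, h4, h5⟩
    refine (norm_deriv_deriv_logGamma_sub_inv_le h2 h3).trans ?_
    rw [norm_inv, norm_pow, Real.norm_of_nonneg h5.le]
    refine (div_le_div_of_nonneg_left (by norm_num) (by positivity)
      (pow_le_pow_left₀ (by positivity) h4 2)).trans (le_of_eq ?_)
    field_simp
    norm_num
  simpa using h1.add (isBigO_inv_shift hlam hc0 hb)

end RotatedArgument

/-! ### The phase -log Δ and its derivatives -/

namespace GammaData

variable (D : GammaData)

/-- The logarithmic main term `log (λ Q² t ^ d)`. -/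
noncomputable def ell (t : ℝ) : ℝ := Real.log (D.lamProd * D.Q ^ 2) + D.degree * Real.log t

lemma ell_eq (t : ℝ) : D.ell t = 2 * Real.log D.Q +
    ∑ j, D.lam j * (2 * (Real.log (D.lam j) + Real.log t)) := by
  have hl : D.lamProd ≠ 0 :=
    Finset.prod_ne_zero_iff.mpr fun j _ => (Real.rpow_pos_of_pos (D.lam_pos j) _).ne'
  have h1 : Real.log D.lamProd = ∑ j, 2 * D.lam j * Real.log (D.lam j) := by
    unfold lamProd
    rw [Real.log_prod fun j _ => (Real.rpow_pos_of_pos (D.lam_pos j) _).ne']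
    exact Finset.sum_congr rfl fun j _ => Real.log_rpow (D.lam_pos j) _
  rw [ell, Real.log_mul hl (pow_ne_zero _ D.Q_pos.ne'), Real.log_pow, h1, degree]
  have h2 : ∑ j, D.lam j * (2 * (Real.log (D.lam j) + Real.log t)) =
      ∑ j, 2 * D.lam j * Real.log (D.lam j) + 2 * (∑ j, D.lam j) * Real.log t := by
    rw [Finset.mul_sum, Finset.sum_mul, ← Finset.sum_add_distrib]
    exact Finset.sum_congr rfl fun j _ => by ring
  rw [h2]
  push_cast
  ring

/-- The argument `λ_j s + μ_j`. -/
noncomputable def argPlus (j : Fin D.r) (s : ℂ) : ℂ := D.lam j * s + D.mu j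

/-- The argument `λ_j (1 - s) + conj μ_j`. -/
noncomputable def argMinus (j : Fin D.r) (s : ℂ) : ℂ :=
  D.lam j * (1 - s) + (starRingEnd ℂ) (D.mu j)

/-- A branch of `-log Δ` in the upper part of the critical strip. -/
noncomputable def phase (s : ℂ) : ℂ :=
  -(Complex.log D.omega + (1 - 2 * s) * (Real.log D.Q : ℂ) +
    ∑ j, (logGamma (D.argMinus j s) - logGamma (D.argPlus j s)))

/-- The derivative of `phase`. -/
noncomputable def phase' (s : ℂ) : ℂ :=
  2 * (Real.log D.Q : ℂ) + ∑ j, (D.lam j : ℂ) *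
    (deriv logGamma (D.argMinus j s) + deriv logGamma (D.argPlus j s))

/-- The second derivative of `phase`. -/
noncomputable def phase'' (s : ℂ) : ℂ :=
  ∑ j, (D.lam j : ℂ) ^ 2 *
    (deriv (deriv logGamma) (D.argPlus j s) - deriv (deriv logGamma) (D.argMinus j s))

lemma argPlus_eq (j : Fin D.r) (s : ℂ) : D.argPlus j s =
    ((D.lam j * s.im : ℝ) : ℂ) * Complex.I + ((D.lam j : ℂ) * s.re + D.mu j) := by
  rw [argPlus]
  conv_lhs => rw [← Complex.re_add_im s]
  push_cast
  ring

lemma argMinus_eq (j : Fin D.r) (s : ℂ) : D.argMinus j s =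
    ((D.lam j * s.im : ℝ) : ℂ) * (-Complex.I) +
      ((D.lam j : ℂ) * (1 - s.re) + (starRingEnd ℂ) (D.mu j)) := by
  rw [argMinus]
  conv_lhs => rw [← Complex.re_add_im s]
  push_cast
  ring

lemma isBigO_const_stripTop (w : ℂ) : (fun _ : ℂ => w) =O[stripTop] (fun _ => (1 : ℝ)) :=
  Asymptotics.isBigO_const_const _ one_ne_zero _

lemma isBigO_offsetPlus (j : Fin D.r) : (fun s : ℂ => (D.lam j : ℂ) * s.re + D.mu j)
    =O[stripTop] (fun _ => (1 : ℝ)) :=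
  (isBigO_re_stripTop.const_mul_left _).add (isBigO_const_stripTop _)

lemma isBigO_offsetMinus (j : Fin D.r) :
    (fun s : ℂ => (D.lam j : ℂ) * (1 - s.re) + (starRingEnd ℂ) (D.mu j))
    =O[stripTop] (fun _ => (1 : ℝ)) :=
  (((isBigO_const_stripTop 1).sub isBigO_re_stripTop).const_mul_left _).add
    (isBigO_const_stripTop _)

lemma eventually_im_arg : ∀ᶠ s in stripTop, ∀ j, 4 ≤ |(D.argPlus j s).im| ∧
    4 ≤ |(D.argMinus j s).im| := by
  rw [eventually_all]
  intro j
  filter_upwards [eventually_im_shift (D.lam_pos j) (c := Complex.I) (by simp) (by simp)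
    (D.isBigO_offsetPlus j), eventually_im_shift (D.lam_pos j) (c := -Complex.I) (by simp) (by simp)
    (D.isBigO_offsetMinus j)] with s h1 h2
  rw [argPlus_eq, argMinus_eq]
  exact ⟨h1.1, h2.1⟩

lemma isBigO_phase' : (fun s => D.phase' s - (D.ell s.im : ℂ)) =O[stripTop]
    (fun s => (s.im)⁻¹) := by
  have h : ∀ j, (fun s => (D.lam j : ℂ) *
      ((deriv logGamma (D.argMinus j s) - (((Real.log (D.lam j) + Real.log s.im : ℝ) : ℂ) +
        Complex.log (-Complex.I))) + (deriv logGamma (D.argPlus j s) -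
        (((Real.log (D.lam j) + Real.log s.im : ℝ) : ℂ) + Complex.log Complex.I))))
      =O[stripTop] (fun s => (s.im)⁻¹) := by
    intro j
    simp_rw [argPlus_eq, argMinus_eq]
    exact ((isBigO_deriv_logGamma (D.lam_pos j) (by simp) (by simp) (D.isBigO_offsetMinus j)).add
      (isBigO_deriv_logGamma (D.lam_pos j) (by simp) (by simp)
        (D.isBigO_offsetPlus j))).const_mul_left _
  refine (Asymptotics.IsBigO.fun_sum (s := Finset.univ) fun j _ => h j).congr_left fun s => ?_
  -- The constants log i and log(-i) cancel, which leaves the real main term ℓ(t).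
  rw [phase', ell_eq, Complex.log_I, Complex.log_neg_I]
  push_cast
  rw [add_sub_add_left_eq_sub, ← Finset.sum_sub_distrib]
  exact Finset.sum_congr rfl fun j _ => by ring

lemma isBigO_phase'' : (fun s => D.phase'' s + Complex.I * ((D.degree / s.im : ℝ) : ℂ)) =O[stripTop]
    (fun s => (s.im ^ 2)⁻¹) := by
  have h : ∀ j, (fun s => (D.lam j : ℂ) ^ 2 *
      ((deriv (deriv logGamma) (D.argPlus j s) - ((D.lam j * s.im : ℝ) * Complex.I)⁻¹) -
        (deriv (deriv logGamma) (D.argMinus j s) - ((D.lam j * s.im : ℝ) * (-Complex.I))⁻¹)))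
      =O[stripTop] (fun s => (s.im ^ 2)⁻¹) := by
    intro j
    simp_rw [argPlus_eq, argMinus_eq]
    exact ((isBigO_deriv_deriv_logGamma (D.lam_pos j) (by simp) (by simp)
      (D.isBigO_offsetPlus j)).sub (isBigO_deriv_deriv_logGamma (D.lam_pos j) (by simp) (by simp)
        (D.isBigO_offsetMinus j))).const_mul_left _
  refine (Asymptotics.IsBigO.fun_sum (s := Finset.univ) fun j _ => h j).congr_left fun s => ?_
  rw [phase'', degree]
  -- Here 1/(iλ_j t) - 1/(-iλ_j t) = -2i/(λ_j t); weighted by λ_j² and summed, this is -i d/t.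
  have h2 : Complex.I * ((2 * ∑ j, D.lam j) / s.im : ℝ) =
      ∑ j, (D.lam j : ℂ) ^ 2 * (-((D.lam j * s.im : ℝ) * Complex.I)⁻¹ +
        ((D.lam j * s.im : ℝ) * (-Complex.I))⁻¹) := by
    push_cast
    rw [mul_div_assoc', Finset.mul_sum, Finset.mul_sum, Finset.sum_div]
    refine Finset.sum_congr rfl fun j _ => ?_
    have : (D.lam j : ℂ) ≠ 0 := by exact_mod_cast (D.lam_pos j).ne'
    rw [mul_neg, mul_inv, inv_neg, mul_inv, mul_inv, Complex.inv_I]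
    field_simp
    ring
  rw [h2, ← Finset.sum_add_distrib]
  exact Finset.sum_congr rfl fun j _ => by ring

lemma hasDerivAt_argPlus (j : Fin D.r) (s : ℂ) : HasDerivAt (D.argPlus j) (D.lam j : ℂ) s := by
  exact (((hasDerivAt_id s).const_mul (D.lam j : ℂ)).add_const (D.mu j)).congr_deriv (mul_one _)

lemma hasDerivAt_argMinus (j : Fin D.r) (s : ℂ) :
    HasDerivAt (D.argMinus j) (-(D.lam j : ℂ)) s := by
  exact ((((hasDerivAt_id s).const_sub 1).const_mul (D.lam j : ℂ)).add_const
    ((starRingEnd ℂ) (D.mu j))).congr_deriv (by ring)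

lemma hasDerivAt_phase {s : ℂ} (hs : ∀ j, 4 ≤ |(D.argPlus j s).im| ∧ 4 ≤ |(D.argMinus j s).im|) :
    HasDerivAt D.phase (D.phase' s) s := by
  have hd : ∀ z : ℂ, 4 ≤ |z.im| → HasDerivAt logGamma (deriv logGamma z) z := fun z hz =>
    (hasDerivAt_logGamma (by linarith)).1.differentiableAt.hasDerivAt
  have hlin : HasDerivAt (fun s : ℂ => Complex.log D.omega + (1 - 2 * s) * (Real.log D.Q : ℂ))
      (-2 * (Real.log D.Q : ℂ)) s := by
    simpa using ((((hasDerivAt_id s).const_mul (2 : ℂ)).const_sub 1).mul_const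
      (Real.log D.Q : ℂ)).const_add (Complex.log D.omega)
  have hsum : HasDerivAt (fun s => ∑ j, (logGamma (D.argMinus j s) - logGamma (D.argPlus j s)))
      (∑ j, (deriv logGamma (D.argMinus j s) * -(D.lam j : ℂ) -
        deriv logGamma (D.argPlus j s) * (D.lam j : ℂ))) s :=
    HasDerivAt.fun_sum fun j _ => ((hd _ (hs j).2).comp s (D.hasDerivAt_argMinus j s)).sub
      ((hd _ (hs j).1).comp s (D.hasDerivAt_argPlus j s))
  refine (hlin.add hsum).neg.congr_deriv ?_
  rw [phase', neg_add, ← Finset.sum_neg_distrib]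
  congr 1
  · ring
  · exact Finset.sum_congr rfl fun j _ => by ring

lemma hasDerivAt_phase' {s : ℂ} (hs : ∀ j, 4 ≤ |(D.argPlus j s).im| ∧ 4 ≤ |(D.argMinus j s).im|) :
    HasDerivAt D.phase' (D.phase'' s) s := by
  have hd : ∀ z : ℂ, 4 ≤ |z.im| →
      HasDerivAt (deriv logGamma) (deriv (deriv logGamma) z) z := fun z hz =>
    (differentiableAt_deriv_logGamma (by linarith)).hasDerivAt
  have hsum : HasDerivAt (fun s => ∑ j, (D.lam j : ℂ) *
      (deriv logGamma (D.argMinus j s) + deriv logGamma (D.argPlus j s)))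
      (∑ j, (D.lam j : ℂ) * (deriv (deriv logGamma) (D.argMinus j s) * -(D.lam j : ℂ) +
        deriv (deriv logGamma) (D.argPlus j s) * (D.lam j : ℂ))) s :=
    HasDerivAt.fun_sum fun j _ => (((hd _ (hs j).2).comp s (D.hasDerivAt_argMinus j s)).add
      ((hd _ (hs j).1).comp s (D.hasDerivAt_argPlus j s))).const_mul _
  refine (hsum.const_add _).congr_deriv ?_
  rw [phase'']
  exact Finset.sum_congr rfl fun j _ => by ring

lemma omega_ne_zero : D.omega ≠ 0 := by
  rw [← norm_pos_iff, D.norm_omega]; exact one_pos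

lemma exp_neg_phase {s : ℂ} (hs : ∀ j, 4 ≤ |(D.argPlus j s).im| ∧ 4 ≤ |(D.argMinus j s).im|) :
    Complex.exp (-D.phase s) = D.Delta s := by
  have hne : ∀ z : ℂ, 4 ≤ |z.im| → z.im ≠ 0 := by
    intro z hz h; rw [h] at hz; norm_num at hz
  have hQ : (D.Q : ℂ) ≠ 0 := by exact_mod_cast D.Q_pos.ne'
  rw [phase, neg_neg, Complex.exp_add, Complex.exp_add, Complex.exp_log D.omega_ne_zero,
    Complex.exp_sum, Delta, Complex.cpow_def_of_ne_zero hQ, Complex.ofReal_log D.Q_pos.le,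
    mul_comm (1 - 2 * s)]
  congr 1
  refine Finset.prod_congr rfl fun j _ => ?_
  rw [Complex.exp_sub, exp_logGamma (hne _ (hs j).1), exp_logGamma (hne _ (hs j).2)]
  rfl

lemma phase_re_eq_zero {s : ℂ} (hs : ∀ j, 4 ≤ |(D.argPlus j s).im| ∧ 4 ≤ |(D.argMinus j s).im|)
    (hre : s.re = 1 / 2) : (D.phase s).re = 0 := by
  have h1 : ‖D.Delta s‖ = 1 := by
    rw [Delta, norm_mul, norm_mul, D.norm_omega, Complex.norm_cpow_eq_rpow_re_of_pos D.Q_pos,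
      norm_prod]
    have : (1 - 2 * s).re = 0 := by simp [hre]
    rw [this, Real.rpow_zero, one_mul, one_mul]
    refine Finset.prod_eq_one fun j _ => ?_
    have hz : (D.lam j : ℂ) * (1 - s) + (starRingEnd ℂ) (D.mu j) =
        (starRingEnd ℂ) (D.argPlus j s) := by
      have : 1 - s = (starRingEnd ℂ) s := by
        apply Complex.ext <;> simp [hre]; norm_num
      rw [this, argPlus, map_add, map_mul, Complex.conj_ofReal]
    have hne : (D.argPlus j s).im ≠ 0 := by
      intro h; have := (hs j).1; rw [h] at this; norm_num at this
    have h0 : Complex.Gamma (D.argPlus j s) ≠ 0 := by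
      rw [← exp_logGamma hne]; exact Complex.exp_ne_zero _
    rw [hz, Complex.Gamma_conj, norm_div, RCLike.norm_conj]
    exact div_self (norm_ne_zero_iff.mpr h0)
  rw [← D.exp_neg_phase hs, Complex.norm_exp] at h1
  simpa using h1

end GammaData

/-! ### Monotone holomorphic maps -/

/-- A holomorphic function whose derivative has real part at least `M` on a convex set
is strongly monotone there. -/
lemma mul_norm_sq_le_re_of_le_re_deriv {U : Set ℂ} (hU : Convex ℝ U) {f f' : ℂ → ℂ} {M : ℝ}
    (hf : ∀ z ∈ U, HasDerivAt f (f' z) z) (hM : ∀ z ∈ U, M ≤ (f' z).re) {a b : ℂ}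
    (ha : a ∈ U) (hb : b ∈ U) :
    M * ‖b - a‖ ^ 2 ≤ ((f b - f a) * (starRingEnd ℂ) (b - a)).re := by
  set φ : ℝ → ℝ := fun τ => (f (a + τ * (b - a)) * (starRingEnd ℂ) (b - a)).re
  have hmem : ∀ τ ∈ Set.Icc (0 : ℝ) 1, a + (τ : ℂ) * (b - a) ∈ U := by
    intro τ hτ
    have := hU.add_smul_sub_mem ha hb hτ
    simpa using this
  have hder : ∀ τ ∈ Set.Icc (0 : ℝ) 1,
      HasDerivAt φ ((f' (a + τ * (b - a))).re * ‖b - a‖ ^ 2) τ := by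
    intro τ hτ
    have h1 : HasDerivAt (fun τ : ℂ => f (a + τ * (b - a)) * (starRingEnd ℂ) (b - a))
        (f' (a + τ * (b - a)) * (1 * (b - a)) * (starRingEnd ℂ) (b - a)) (τ : ℂ) := by
      refine HasDerivAt.mul_const ?_ _
      exact (hf _ (hmem τ hτ)).comp (τ : ℂ) (((hasDerivAt_id (τ : ℂ)).mul_const (b - a)).const_add a)
    refine h1.real_of_complex.congr_deriv ?_
    rw [one_mul, mul_assoc, Complex.mul_conj, Complex.re_mul_ofReal, Complex.normSq_eq_norm_sq]
  have hcont : ContinuousOn φ (Set.Icc 0 1) := fun τ hτ =>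
    (hder τ hτ).continuousAt.continuousWithinAt
  obtain ⟨ξ, hξ, h⟩ := exists_hasDerivAt_eq_slope φ _ zero_lt_one hcont
    fun τ hτ => hder τ (Set.Ioo_subset_Icc_self hτ)
  have h2 : φ 1 - φ 0 = ((f b - f a) * (starRingEnd ℂ) (b - a)).re := by
    simp only [φ]
    rw [← Complex.sub_re, ← sub_mul]
    simp
  rw [sub_zero, div_one, h2] at h
  rw [← h]
  exact mul_le_mul_of_nonneg_right (hM _ (hmem ξ (Set.Ioo_subset_Icc_self hξ))) (by positivity)

/-- Cauchy-Schwarz applied to strong monotonicity: the map expands distances by at least M, hence is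
injective when M > 0. -/
lemma mul_norm_le_norm_sub_of_le_re_deriv {U : Set ℂ} (hU : Convex ℝ U) {f f' : ℂ → ℂ} {M : ℝ}
    (hf : ∀ z ∈ U, HasDerivAt f (f' z) z) (hM : ∀ z ∈ U, M ≤ (f' z).re) {a b : ℂ}
    (ha : a ∈ U) (hb : b ∈ U) : M * ‖b - a‖ ≤ ‖f b - f a‖ := by
  rcases eq_or_ne b a with rfl | hne
  · simp
  have h1 := mul_norm_sq_le_re_of_le_re_deriv hU hf hM ha hb
  have h2 := (Complex.re_le_norm ((f b - f a) * (starRingEnd ℂ) (b - a)))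
  rw [norm_mul, RCLike.norm_conj] at h2
  have h3 : 0 < ‖b - a‖ := norm_pos_iff.mpr (sub_ne_zero.mpr hne)
  nlinarith

/-- The product differs from 1 by less than 1. It decides the sign of the acceleration of the
ordinate in `re_acceleration_nonpos`. -/
lemma re_mul_pow_three_pos {a b : ℂ} (ha : ‖a‖ ≤ 1 / 10) (hb : ‖b‖ ≤ 1 / 8) :
    0 < ((1 + a) * (1 + b) ^ 3).re := by
  have h1 : (1 + a) * (1 + b) ^ 3 = 1 + (a + (1 + a) * (b * (3 + b * (3 + b)))) := by ring
  have h2 : ‖a + (1 + a) * (b * (3 + b * (3 + b)))‖ < 1 := by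
    have h3 : ‖3 + b‖ ≤ 3 + 1 / 8 := (norm_add_le _ _).trans (by simpa using hb)
    have h4 : ‖b * (3 + b)‖ ≤ 1 / 8 * (3 + 1 / 8) := by
      rw [norm_mul]; exact mul_le_mul hb h3 (norm_nonneg _) (by norm_num)
    have h5 : ‖3 + b * (3 + b)‖ ≤ 3 + 1 / 8 * (3 + 1 / 8) :=
      (norm_add_le _ _).trans (by simpa using h4)
    have h6 : ‖b * (3 + b * (3 + b))‖ ≤ 1 / 8 * (3 + 1 / 8 * (3 + 1 / 8)) := by
      rw [norm_mul]; exact mul_le_mul hb h5 (norm_nonneg _) (by norm_num)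
    have h7 : ‖1 + a‖ ≤ 1 + 1 / 10 := (norm_add_le _ _).trans (by simpa using ha)
    have h8 : ‖(1 + a) * (b * (3 + b * (3 + b)))‖ ≤
        (1 + 1 / 10) * (1 / 8 * (3 + 1 / 8 * (3 + 1 / 8))) := by
      rw [norm_mul]; exact mul_le_mul h7 h6 (norm_nonneg _) (by norm_num)
    refine (norm_add_le _ _).trans_lt ?_
    linarith
  rw [h1, Complex.add_re, Complex.one_re]
  have := (abs_le.mp (Complex.abs_re_le_norm (a + (1 + a) * (b * (3 + b * (3 + b)))))).1
  linarith

/-! ### The phase on a half strip -/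

namespace GammaData

variable (D : GammaData)

/-- The open half strip `-1 < Re s < 2`, `Im s > t`. -/
def halfStrip (t : ℝ) : Set ℂ := {s | (-1 < s.re ∧ s.re < 2) ∧ t < s.im}

lemma convex_halfStrip (t : ℝ) : Convex ℝ (halfStrip t) :=
  ((convex_halfSpace_re_gt (-1)).inter (convex_halfSpace_re_lt 2)).inter (convex_halfSpace_im_gt t)

/-- The estimates for `phase` in a half strip. -/
structure PhaseBounds (M K t₀ : ℝ) : Prop where
  K_nonneg : 0 ≤ K
  one_le_M : 1 ≤ M
  one_le_t₀ : 1 ≤ t₀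
  arg_im : ∀ s ∈ halfStrip t₀, ∀ j, 4 ≤ |(D.argPlus j s).im| ∧ 4 ≤ |(D.argMinus j s).im|
  phase'_le : ∀ s ∈ halfStrip t₀, ‖D.phase' s - (D.ell s.im : ℂ)‖ ≤ K / s.im
  phase''_le : ∀ s ∈ halfStrip t₀,
    ‖D.phase'' s + Complex.I * ((D.degree / s.im : ℝ) : ℂ)‖ ≤ K / s.im ^ 2
  le_ell : ∀ t, t₀ < t → 2 * M ≤ D.ell t
  K_div_le : ∀ t, t₀ < t → K / t ≤ 1 / 20
  K_div_le_degree : ∀ t, t₀ < t → K / t ≤ D.degree / 20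

lemma tendsto_ell (hd : 0 < D.degree) : Tendsto D.ell atTop atTop :=
  tendsto_atTop_add_const_left _ _ (Real.tendsto_log_atTop.const_mul_atTop hd)

lemma exists_phaseBounds (hd : 0 < D.degree) {M : ℝ} (hM : 1 ≤ M) :
    ∃ K t₀, D.PhaseBounds M K t₀ := by
  obtain ⟨K₁, hK₁⟩ := D.isBigO_phase'.bound
  obtain ⟨K₂, hK₂⟩ := D.isBigO_phase''.bound
  set K := |K₁| + |K₂|
  have hK : 0 ≤ K := by positivity
  have hdiv : Tendsto (fun t : ℝ => K / t) atTop (𝓝 0) := tendsto_const_nhds.div_atTop tendsto_id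
  obtain ⟨t₁, h1⟩ := eventually_stripTop.mp (hK₁.and (hK₂.and D.eventually_im_arg))
  obtain ⟨t₂, h2⟩ := eventually_atTop.mp (((D.tendsto_ell hd).eventually_ge_atTop (2 * M)).and
    ((hdiv.eventually_le_const (show (0 : ℝ) < 1 / 20 by norm_num)).and
      (hdiv.eventually_le_const (show 0 < D.degree / 20 by linarith))))
  set t₀ := max 1 (max t₁ t₂)
  have ht1 : 1 ≤ t₀ := le_max_left _ _
  have ht2 : t₁ ≤ t₀ := (le_max_left _ _).trans (le_max_right _ _)
  have ht3 : t₂ ≤ t₀ := (le_max_right _ _).trans (le_max_right _ _)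
  refine ⟨K, t₀, hK, hM, ht1, ?_, ?_, ?_, ?_, ?_, ?_⟩
  · rintro s ⟨⟨ha, hb⟩, hc⟩
    exact (h1 s ha hb (by linarith)).2.2
  · rintro s ⟨⟨ha, hb⟩, hc⟩
    have hs : 0 < s.im := by linarith
    refine (h1 s ha hb (by linarith)).1.trans ?_
    rw [norm_inv, Real.norm_of_nonneg hs.le, div_eq_mul_inv]
    refine mul_le_mul_of_nonneg_right ?_ (by positivity)
    linarith [le_abs_self K₁, abs_nonneg K₂]
  · rintro s ⟨⟨ha, hb⟩, hc⟩
    have hs : 0 < s.im := by linarith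
    refine (h1 s ha hb (by linarith)).2.1.trans ?_
    rw [norm_inv, norm_pow, Real.norm_of_nonneg hs.le, div_eq_mul_inv]
    refine mul_le_mul_of_nonneg_right ?_ (by positivity)
    linarith [le_abs_self K₂, abs_nonneg K₁]
  · exact fun t ht => (h2 t (by linarith)).1
  · exact fun t ht => (h2 t (by linarith)).2.1
  · exact fun t ht => (h2 t (by linarith)).2.2

namespace PhaseBounds

variable {D} {M K t₀ : ℝ} (h : D.PhaseBounds M K t₀)
include h

lemma hasDerivAt {s : ℂ} (hs : s ∈ halfStrip t₀) : HasDerivAt D.phase (D.phase' s) s :=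
  D.hasDerivAt_phase (h.arg_im s hs)

lemma re_phase'_ge {s : ℂ} (hs : s ∈ halfStrip t₀) : D.ell s.im - K / s.im ≤ (D.phase' s).re := by
  have h1 := (abs_le.mp ((Complex.abs_re_le_norm _).trans (h.phase'_le s hs))).1
  rw [Complex.sub_re, Complex.ofReal_re] at h1
  linarith

lemma ell_sub_ge {t : ℝ} (ht : t₀ < t) : M ≤ D.ell t - K / t ∧ 2 ≤ D.ell t := by
  have h1 := h.le_ell t ht
  have h2 := h.K_div_le t ht
  have h3 := h.one_le_M
  constructor <;> linarith

lemma re_phase'_ge_M {s : ℂ} (hs : s ∈ halfStrip t₀) : M ≤ (D.phase' s).re :=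
  (h.ell_sub_ge hs.2).1.trans (h.re_phase'_ge hs)

/-- Besides injectivity this yields an ordering: when two values of the phase differ by a nonzero
purely imaginary number, the point with the higher value has the larger ordinate. -/
lemma strong_mono {a b : ℂ} (ha : a ∈ halfStrip t₀) (hb : b ∈ halfStrip t₀) :
    M * ‖b - a‖ ^ 2 ≤ ((D.phase b - D.phase a) * (starRingEnd ℂ) (b - a)).re :=
  mul_norm_sq_le_re_of_le_re_deriv (convex_halfStrip t₀) (fun _ hz => h.hasDerivAt hz)
    (fun _ hz => h.re_phase'_ge_M hz) ha hb

lemma norm_sub_le {a b : ℂ} (ha : a ∈ halfStrip t₀) (hb : b ∈ halfStrip t₀) :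
    M * ‖b - a‖ ≤ ‖D.phase b - D.phase a‖ :=
  mul_norm_le_norm_sub_of_le_re_deriv (convex_halfStrip t₀) (fun _ hz => h.hasDerivAt hz)
    (fun _ hz => h.re_phase'_ge_M hz) ha hb

lemma injOn : Set.InjOn D.phase (halfStrip t₀) := by
  intro a ha b hb hab
  have h1 := h.norm_sub_le hb ha
  rw [hab, sub_self, norm_zero] at h1
  have h2 := h.one_le_M
  have h3 : ‖a - b‖ = 0 := le_antisymm (by nlinarith [norm_nonneg (a - b)]) (norm_nonneg _)
  exact sub_eq_zero.mp (norm_eq_zero.mp h3)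

lemma phase'_ne_zero {s : ℂ} (hs : s ∈ halfStrip t₀) : D.phase' s ≠ 0 := by
  intro h0
  have := h.re_phase'_ge_M hs
  rw [h0, Complex.zero_re] at this
  linarith [h.one_le_M]

lemma norm_ell_div_sub_one_le {s : ℂ} (hs : s ∈ halfStrip t₀) :
    ‖(D.ell s.im : ℂ) / D.phase' s - 1‖ ≤ 1 / 8 := by
  have h0 := h.phase'_ne_zero hs
  have h1 : (D.ell s.im : ℂ) / D.phase' s - 1 = -(D.phase' s - D.ell s.im) / D.phase' s := by
    field_simp
    ring
  have h2 : 1 ≤ ‖D.phase' s‖ :=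
    h.one_le_M.trans ((h.re_phase'_ge_M hs).trans (Complex.re_le_norm _))
  rw [h1, norm_div, norm_neg, div_le_iff₀ (by linarith)]
  have := h.phase'_le s hs
  have := h.K_div_le s.im hs.2
  linarith

/-- The velocity of the ordinate along the curve `phase = c + i u`. -/
lemma re_inv_phase'_bounds {s : ℂ} (hs : s ∈ halfStrip t₀) :
    7 / 8 / D.ell s.im ≤ (1 / D.phase' s).re ∧
      (1 / D.phase' s).re ≤ 1 / (D.ell s.im - K / s.im) := by
  have hl := h.ell_sub_ge hs.2
  have hl0 : 0 < D.ell s.im := by linarith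
  constructor
  · have h1 := (abs_le.mp ((Complex.abs_re_le_norm _).trans (h.norm_ell_div_sub_one_le hs))).1
    have h2 : (D.ell s.im : ℂ) / D.phase' s = (D.ell s.im : ℂ) * (1 / D.phase' s) := by ring
    rw [Complex.sub_re, h2, Complex.re_ofReal_mul, Complex.one_re] at h1
    rw [div_le_iff₀ hl0]
    linarith
  · have hM := h.one_le_M
    have h3 := h.re_phase'_ge hs
    refine (Complex.re_le_norm _).trans ?_
    rw [norm_div, norm_one]
    exact one_div_le_one_div_of_le (by linarith) (h3.trans (Complex.re_le_norm _))

/-- The ordinate is concave along the curve `phase = c + i u`. -/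
lemma re_acceleration_nonpos (hd : 0 < D.degree) {s : ℂ} (hs : s ∈ halfStrip t₀) :
    (-(D.phase'' s * (Complex.I / D.phase' s)) / D.phase' s ^ 2).re ≤ 0 := by
  have h0 := h.phase'_ne_zero hs
  have ht : 0 < s.im := by linarith [h.one_le_t₀, hs.2]
  have hl : 0 < D.ell s.im := by linarith [(h.ell_sub_ge hs.2).2]
  set η := D.phase'' s + Complex.I * ((D.degree / s.im : ℝ) : ℂ) with hη
  set p := D.phase' s with hp
  have hdt : (0 : ℝ) < D.degree / s.im := by positivity
  have hdtc : ((D.degree / s.im : ℝ) : ℂ) ≠ 0 := by exact_mod_cast hdt.ne'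
  have hlc : (D.ell s.im : ℂ) ≠ 0 := by exact_mod_cast hl.ne'
  have ha : ‖Complex.I * η / ((D.degree / s.im : ℝ) : ℂ)‖ ≤ 1 / 10 := by
    rw [norm_div, norm_mul, Complex.norm_I, one_mul, Complex.norm_real, Real.norm_of_nonneg hdt.le,
      div_le_iff₀ hdt]
    refine (h.phase''_le s hs).trans ?_
    have h1 := h.K_div_le_degree s.im hs.2
    have h2 : K / s.im ^ 2 = K / s.im / s.im := by rw [sq, div_div]
    rw [h2]
    have h3 : 1 / 10 * (D.degree / s.im) = (D.degree / 10) / s.im := by ring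
    rw [h3]
    exact div_le_div_of_nonneg_right (by linarith) ht.le
  have hpos := re_mul_pow_three_pos ha (h.norm_ell_div_sub_one_le hs)
  -- With δ = d/t and `phase''` = η - iδ, one has -i·`phase''`/p³ = -δ(1 + iη/δ)/p³; then p is
  -- compared with ℓ.
  have hrw : -(D.phase'' s * (Complex.I / p)) / p ^ 2 =
      ((-(D.degree / s.im / D.ell s.im ^ 3) : ℝ) : ℂ) *
        ((1 + Complex.I * η / ((D.degree / s.im : ℝ) : ℂ)) *
          (1 + ((D.ell s.im : ℂ) / p - 1)) ^ 3) := by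
    have hp2 : D.phase'' s = η - Complex.I * ((D.degree / s.im : ℝ) : ℂ) := by rw [hη]; ring
    have hdd : ((-(D.degree / s.im / D.ell s.im ^ 3) : ℝ) : ℂ) =
      -(((D.degree / s.im : ℝ) : ℂ) / (D.ell s.im : ℂ) ^ 3) := by push_cast; ring
    rw [hp2, hdd]
    generalize ((D.degree / s.im : ℝ) : ℂ) = δ at hdtc
    field_simp
    linear_combination δ * (D.ell s.im : ℂ) ^ 3 * Complex.I_sq
  rw [hrw, Complex.re_ofReal_mul]
  have : 0 < D.degree / s.im / D.ell s.im ^ 3 := by positivity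
  nlinarith

end PhaseBounds

end GammaData

/-! ### Level curves of the phase and the sequence of a-points -/

namespace GammaData

variable (D : GammaData)

/-- `p` lists all nontrivial `a`-points with ordinate at least `Im (p 0)`; they are simple,
and their gaps behave like `2π / log (λ Q² t ^ d)`. -/
structure IsPointSequence (a : ℂ) (K : ℝ) (p : ℕ → ℂ) : Prop where
  K_nonneg : 0 ≤ K
  one_le_im : 1 ≤ (p 0).im
  mem : ∀ n, p n ∈ D.nontrivialPoints a
  multiplicity_eq : ∀ n, D.multiplicity a (p n) = 1
  strictMono : StrictMono fun n => (p n).im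
  surj : ∀ s ∈ D.nontrivialPoints a, (p 0).im ≤ s.im → ∃ n, p n = s
  gap_antitone : Antitone fun n => (p (n + 1)).im - (p n).im
  one_le_ell_sub : ∀ n, 1 ≤ D.ell (p n).im - K / (p n).im
  gap_le : ∀ n, ((p (n + 1)).im - (p n).im) * (D.ell (p n).im - K / (p n).im) ≤ 2 * Real.pi
  one_le_gap : ∀ n, 1 ≤ ((p (n + 1)).im - (p n).im) * D.ell (p (n + 1)).im

lemma isOpen_halfStrip (t : ℝ) : IsOpen (halfStrip t) :=
  ((isOpen_lt continuous_const Complex.continuous_re).inter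
    (isOpen_lt Complex.continuous_re continuous_const)).inter
    (isOpen_lt continuous_const Complex.continuous_im)

lemma ell_mono (hd : 0 < D.degree) {t t' : ℝ} (ht : 0 < t) (h : t ≤ t') : D.ell t ≤ D.ell t' := by
  have := Real.log_le_log ht h
  unfold ell
  nlinarith

variable {D} {M K t₀ : ℝ}

/-- On the critical line the phase is imaginary and runs through all large iu. The disc of radius
1/2 about the point with value iu lies in the closed critical strip, and its boundary is mapped to
distance at least M/2 from iu. By the quantitative open mapping theorem the image covers the disc of
radius M/4 about iu, which contains c + iu. -/
lemma PhaseBounds.exists_solution (h : D.PhaseBounds M K t₀) {c : ℝ} (hc : |c| < M / 4) :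
    ∃ u₁ : ℝ, ∀ u, u₁ ≤ u → ∃ s ∈ halfStrip t₀, 0 ≤ s.re ∧ s.re ≤ 1 ∧
      D.phase s = (c : ℂ) + u * Complex.I := by
  set ρ : ℝ → ℂ := fun t => (1 / 2 : ℝ) + t * Complex.I with hρ
  have hρre : ∀ t, (ρ t).re = 1 / 2 := fun t => by simp [hρ]
  have hρim : ∀ t, (ρ t).im = t := fun t => by simp [hρ]
  have hρmem : ∀ t, t₀ < t → ρ t ∈ halfStrip t₀ := by
    intro t ht
    refine ⟨⟨?_, ?_⟩, ?_⟩
    · rw [hρre]; norm_num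
    · rw [hρre]; norm_num
    · rw [hρim]; exact ht
  set v : ℝ → ℝ := fun t => (D.phase (ρ t)).im
  have hM := h.one_le_M
  refine ⟨v (t₀ + 1), fun u hu => ?_⟩
  -- The imaginary part grows at rate at least M ≥ 1 along the critical line, so it has reached u by
  -- this height.
  set T := t₀ + 1 + (u - v (t₀ + 1)) with hT
  have hle : t₀ + 1 ≤ T := by linarith
  have hcont : ContinuousOn v (Set.Icc (t₀ + 1) T) := by
    intro t ht
    have h1 := (h.hasDerivAt (hρmem t (by linarith [ht.1]))).continuousAt
    have h2 : Continuous ρ := by fun_prop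
    have h3 : ContinuousAt (fun t => D.phase (ρ t)) t :=
      ContinuousAt.comp (f := ρ) h1 h2.continuousAt
    exact (Complex.continuous_im.continuousAt.comp h3).continuousWithinAt
  have hvT : u ≤ v T := by
    have h1 := h.strong_mono (hρmem (t₀ + 1) (by linarith)) (hρmem T (by linarith))
    have h2 : ρ T - ρ (t₀ + 1) = ((u - v (t₀ + 1) : ℝ) : ℂ) * Complex.I := by
      simp only [hρ, hT]; push_cast; ring
    have h3 : ((D.phase (ρ T) - D.phase (ρ (t₀ + 1))) *
        (starRingEnd ℂ) (((u - v (t₀ + 1) : ℝ) : ℂ) * Complex.I)).re =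
        (v T - v (t₀ + 1)) * (u - v (t₀ + 1)) := by
      simp [v]
    rw [h2, h3, norm_mul, Complex.norm_I, mul_one, Complex.norm_real, Real.norm_eq_abs, sq_abs] at h1
    rcases eq_or_lt_of_le hu with h4 | h4
    · have : T = t₀ + 1 := by rw [hT, h4]; ring
      rw [this, h4]
    · by_contra h5
      nlinarith
  obtain ⟨t, ht, hvt⟩ := intermediate_value_Icc hle hcont ⟨hu, hvT⟩
  have ht0 : t₀ + 1 ≤ t := ht.1
  have hball : ∀ s ∈ Metric.closedBall (ρ t) (1 / 2),
      s ∈ halfStrip t₀ ∧ 0 ≤ s.re ∧ s.re ≤ 1 := by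
    intro s hs
    rw [Metric.mem_closedBall, dist_eq_norm] at hs
    have h1 := abs_le.mp ((Complex.abs_re_le_norm _).trans hs)
    have h2 := abs_le.mp ((Complex.abs_im_le_norm _).trans hs)
    rw [Complex.sub_re, hρre] at h1
    rw [Complex.sub_im, hρim] at h2
    exact ⟨⟨⟨by linarith, by linarith⟩, by linarith⟩, by linarith, by linarith⟩
  have hmem := hρmem t (by linarith)
  have hdc : DiffContOnCl ℂ D.phase (Metric.ball (ρ t) (1 / 2)) := by
    apply DifferentiableOn.diffContOnCl
    rw [closure_ball _ (by norm_num)]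
    exact fun s hs => (h.hasDerivAt (hball s hs).1).differentiableAt.differentiableWithinAt
  have hfreq : ∃ᶠ z in 𝓝 (ρ t), D.phase z ≠ D.phase (ρ t) := by
    have h1 : ∀ᶠ z in 𝓝[≠] (ρ t), D.phase z ≠ D.phase (ρ t) := by
      filter_upwards [self_mem_nhdsWithin,
        nhdsWithin_le_nhds ((isOpen_halfStrip t₀).mem_nhds hmem)] with z hz hz2 heq
      exact hz (h.injOn hz2 hmem heq)
    exact h1.frequently.filter_mono nhdsWithin_le_nhds
  have hsub := hdc.ball_subset_image_closedBall (ε := M / 2) (by norm_num) (fun z hz => by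
    have h1 := h.norm_sub_le hmem (hball z (Metric.sphere_subset_closedBall hz)).1
    rw [mem_sphere_iff_norm.mp hz] at h1
    linarith) hfreq
  have hval : D.phase (ρ t) = (u : ℂ) * Complex.I := by
    apply Complex.ext
    · rw [D.phase_re_eq_zero (h.arg_im _ hmem) (hρre t)]; simp
    · rw [← hvt]; simp [v]
  have hw : (c : ℂ) + u * Complex.I ∈ Metric.ball (D.phase (ρ t)) (M / 2 / 2) := by
    rw [Metric.mem_ball, dist_eq_norm, hval, add_sub_cancel_right, Complex.norm_real,
      Real.norm_eq_abs]
    linarith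
  obtain ⟨s, hs, hps⟩ := hsub hw
  exact ⟨s, (hball s hs).1, (hball s hs).2.1, (hball s hs).2.2, hps⟩

/-- A curve along which `phase` has constant real part. -/
structure IsLevelCurve (D : GammaData) (t₀ c u₁ : ℝ) (S : ℝ → ℂ) : Prop where
  mem : ∀ u, u₁ ≤ u → S u ∈ halfStrip t₀
  re_nonneg : ∀ u, u₁ ≤ u → 0 ≤ (S u).re
  re_le_one : ∀ u, u₁ ≤ u → (S u).re ≤ 1
  phase_eq : ∀ u, u₁ ≤ u → D.phase (S u) = (c : ℂ) + u * Complex.I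

lemma PhaseBounds.exists_levelCurve (h : D.PhaseBounds M K t₀) {c : ℝ} (hc : |c| < M / 4) :
    ∃ u₁ S, IsLevelCurve D t₀ c u₁ S := by
  obtain ⟨u₁, hu⟩ := h.exists_solution hc
  choose! S hS using hu
  exact ⟨u₁, S, fun u hu => (hS u hu).1, fun u hu => (hS u hu).2.1, fun u hu => (hS u hu).2.2.1,
    fun u hu => (hS u hu).2.2.2⟩

namespace IsLevelCurve

variable {c u₁ : ℝ} {S : ℝ → ℂ} (hS : IsLevelCurve D t₀ c u₁ S) (h : D.PhaseBounds M K t₀)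
include hS

lemma phase_sub {u u' : ℝ} (hu : u₁ ≤ u) (hu' : u₁ ≤ u') :
    D.phase (S u') - D.phase (S u) = ((u' - u : ℝ) : ℂ) * Complex.I := by
  rw [hS.phase_eq u hu, hS.phase_eq u' hu']
  push_cast
  ring

include h

/-- Expansion by M ≥ 1 makes the inverse of the phase 1-Lipschitz. This supplies the continuity of
S, whose values were only chosen pointwise. -/
lemma norm_sub_le {u u' : ℝ} (hu : u₁ ≤ u) (hu' : u₁ ≤ u') : ‖S u' - S u‖ ≤ |u' - u| := by
  have h1 := h.norm_sub_le (hS.mem u hu) (hS.mem u' hu')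
  rw [hS.phase_sub hu hu', norm_mul, Complex.norm_I, mul_one, Complex.norm_real,
    Real.norm_eq_abs] at h1
  nlinarith [h.one_le_M, norm_nonneg (S u' - S u)]

/-- The inverse function rule: the first-order expansion of the phase at S(u), divided by its
nonzero derivative, with remainders controlled by the Lipschitz bound. -/
lemma hasDerivAt {u : ℝ} (hu : u₁ < u) :
    HasDerivAt S (Complex.I / D.phase' (S u)) u := by
  have hev : ∀ᶠ x in 𝓝 u, u₁ ≤ x := (lt_mem_nhds hu).mono fun x hx => le_of_lt hx
  have hO : (fun x => S x - S u) =O[𝓝 u] (fun x => x - u) := by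
    refine Asymptotics.IsBigO.of_bound 1 ?_
    filter_upwards [hev] with x hx
    rw [one_mul]
    exact hS.norm_sub_le h hu.le hx
  have hcont : Tendsto S (𝓝 u) (𝓝 (S u)) := by
    rw [← tendsto_sub_nhds_zero_iff]
    refine hO.trans_tendsto ?_
    rw [tendsto_sub_nhds_zero_iff]
    exact tendsto_id
  have hne := h.phase'_ne_zero (hS.mem u hu.le)
  have h1 := (hasDerivAt_iff_isLittleO.mp (h.hasDerivAt (hS.mem u hu.le))).comp_tendsto hcont
  rw [hasDerivAt_iff_isLittleO]
  have h2 := ((h1.trans_isBigO hO).const_mul_left (-(D.phase' (S u))⁻¹))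
  refine h2.congr' ?_ EventuallyEq.rfl
  filter_upwards [hev] with x hx
  simp only [Function.comp, smul_eq_mul, Complex.real_smul]
  rw [hS.phase_sub hu.le hx]
  field_simp
  ring

lemma hasDerivAt_im {u : ℝ} (hu : u₁ < u) :
    HasDerivAt (fun u => (S u).im) (1 / D.phase' (S u)).re u := by
  have h1 := (hS.hasDerivAt h hu)
  have h2 := (Complex.imCLM.hasFDerivAt.comp_hasDerivAt u h1)
  refine h2.congr_deriv ?_
  rw [Complex.imCLM_apply, ← mul_one_div, Complex.I_mul_im]

lemma hasDerivAt_re_inv {u : ℝ} (hu : u₁ < u) :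
    HasDerivAt (fun u => (1 / D.phase' (S u)).re)
      (-(D.phase'' (S u) * (Complex.I / D.phase' (S u))) / D.phase' (S u) ^ 2).re u := by
  have hmem := hS.mem u hu.le
  have hne := h.phase'_ne_zero hmem
  have h1 : HasDerivAt (fun x => D.phase' (S x))
      (D.phase'' (S u) * (Complex.I / D.phase' (S u))) u :=
    (D.hasDerivAt_phase' (h.arg_im _ hmem)).comp u (hS.hasDerivAt h hu)
  have h2 := (Complex.reCLM.hasFDerivAt.comp_hasDerivAt u (h1.inv hne))
  simpa [Function.comp_def] using h2

/-- The velocity Re(1/`phase'`) has non-positive derivative. This concavity is the source of the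
decreasing gaps. -/
lemma concaveOn_im (hd : 0 < D.degree) : ConcaveOn ℝ (Set.Ioi u₁) (fun u => (S u).im) := by
  have hder : ∀ u ∈ Set.Ioi u₁, deriv (fun u => (S u).im) u = (1 / D.phase' (S u)).re :=
    fun u hu => (hS.hasDerivAt_im h hu).deriv
  refine AntitoneOn.concaveOn_of_deriv (convex_Ioi u₁)
    (fun u hu => (hS.hasDerivAt_im h hu).continuousAt.continuousWithinAt) ?_ ?_
  · rw [interior_Ioi]
    exact fun u hu => (hS.hasDerivAt_im h hu).differentiableAt.differentiableWithinAt
  · rw [interior_Ioi]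
    have hanti : AntitoneOn (fun u => (1 / D.phase' (S u)).re) (Set.Ioi u₁) := by
      refine antitoneOn_of_deriv_nonpos (convex_Ioi u₁)
        (fun u hu => (hS.hasDerivAt_re_inv h hu).continuousAt.continuousWithinAt) ?_ ?_
      · rw [interior_Ioi]
        exact fun u hu => (hS.hasDerivAt_re_inv h hu).differentiableAt.differentiableWithinAt
      · rw [interior_Ioi]
        intro u hu
        rw [(hS.hasDerivAt_re_inv h hu).deriv]
        exact h.re_acceleration_nonpos hd (hS.mem u (le_of_lt hu))
    exact hanti.congr fun u hu => (hder u hu).symm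

lemma im_lt_im {u u' : ℝ} (hu : u₁ ≤ u) (huu : u < u') : (S u).im < (S u').im := by
  have hu' := hu.trans huu.le
  have h1 := h.strong_mono (hS.mem u hu) (hS.mem u' hu')
  rw [hS.phase_sub hu hu'] at h1
  have h2 : (((u' - u : ℝ) : ℂ) * Complex.I * (starRingEnd ℂ) (S u' - S u)).re =
      (u' - u) * ((S u').im - (S u).im) := by
    simp
    ring
  rw [h2] at h1
  have h3 : 0 < ‖S u' - S u‖ := by
    rw [norm_pos_iff]
    intro h0
    have h4 := hS.phase_sub hu hu'
    rw [sub_eq_zero.mp h0, sub_self] at h4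
    have := congrArg Complex.im h4
    simp at this
    linarith
  have h4 : 0 < M * ‖S u' - S u‖ ^ 2 := by have := h.one_le_M; positivity
  by_contra h5
  nlinarith

end IsLevelCurve

/-- Taking logarithms in exp(-`phase`) = a leaves the freedom 2πik: all solutions share one real
part of the phase, and the imaginary parts form an arithmetic progression. -/
lemma PhaseBounds.Delta_eq_iff (h : D.PhaseBounds M K t₀) {a s : ℂ} (ha : a ≠ 0)
    (hs : s ∈ halfStrip t₀) : D.Delta s = a ↔ ∃ k : ℤ, D.phase s =
      ((-Real.log ‖a‖ : ℝ) : ℂ) + ((-a.arg + 2 * Real.pi * k : ℝ) : ℂ) * Complex.I := by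
  rw [← D.exp_neg_phase (h.arg_im s hs)]
  have h1 : a = Complex.exp (Complex.log a) := (Complex.exp_log ha).symm
  conv_lhs => rw [h1]
  rw [Complex.exp_eq_exp_iff_exists_int]
  have hlog : Complex.log a = (Real.log ‖a‖ : ℂ) + a.arg * Complex.I := rfl
  constructor
  · rintro ⟨k, hk⟩
    refine ⟨-k, ?_⟩
    rw [← neg_neg (D.phase s), hk, hlog]
    push_cast
    ring
  · rintro ⟨k, hk⟩
    refine ⟨-k, ?_⟩
    rw [hk, hlog]
    push_cast
    ring

/-- Near s one has Δ' = -`phase'`·Δ, and neither factor vanishes. -/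
lemma PhaseBounds.multiplicity_eq_one (h : D.PhaseBounds M K t₀) {a s : ℂ}
    (hs : s ∈ halfStrip t₀) (hDs : D.Delta s = a) : D.multiplicity a s = 1 := by
  have hev : ∀ᶠ z in 𝓝 s, Complex.exp (-D.phase z) = D.Delta z := by
    filter_upwards [(isOpen_halfStrip t₀).mem_nhds hs] with z hz
    exact D.exp_neg_phase (h.arg_im z hz)
  have hder : HasDerivAt (fun z => Complex.exp (-D.phase z))
      (Complex.exp (-D.phase s) * -D.phase' s) s := (h.hasDerivAt hs).neg.cexp
  have hder' : HasDerivAt D.Delta (Complex.exp (-D.phase s) * -D.phase' s) s :=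
    hder.congr_of_eventuallyEq (hev.mono fun z hz => hz.symm)
  have han : AnalyticAt ℂ D.Delta s := by
    rw [Complex.analyticAt_iff_eventually_differentiableAt]
    filter_upwards [(isOpen_halfStrip t₀).mem_nhds hs] with z hz
    have hev' : ∀ᶠ w in 𝓝 z, D.Delta w = Complex.exp (-D.phase w) := by
      filter_upwards [(isOpen_halfStrip t₀).mem_nhds hz] with w hw
      exact (D.exp_neg_phase (h.arg_im w hw)).symm
    exact ((h.hasDerivAt hz).neg.cexp.congr_of_eventuallyEq hev').differentiableAt
  have h1 := han.analyticOrderAt_sub_eq_one_of_deriv_ne_zero (by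
    rw [hder'.deriv]
    exact mul_ne_zero (Complex.exp_ne_zero _) (neg_ne_zero.mpr (h.phase'_ne_zero hs)))
  rw [hDs] at h1
  exact h1

theorem exists_isPointSequence (D : GammaData) (hd : 0 < D.degree) {a : ℂ} (ha : a ≠ 0) :
    ∃ K p, D.IsPointSequence a K p := by
  set c : ℝ := -Real.log ‖a‖ with hc
  -- This M satisfies |c| < M/4, as `exists_solution` requires.
  obtain ⟨K, t₀, h⟩ := D.exists_phaseBounds hd (M := 1 + 4 * |c|)
    (by linarith [abs_nonneg c])
  obtain ⟨u₁, S, hS⟩ := h.exists_levelCurve (c := c) (by linarith)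
  -- From k₀ on the parameters -arg a + 2πk lie beyond u₁, where the curve is defined.
  obtain ⟨k₀, hk₀⟩ := exists_nat_gt ((u₁ + a.arg) / (2 * Real.pi))
  have hpi := Real.pi_pos
  set U : ℕ → ℝ := fun n => -a.arg + 2 * Real.pi * (k₀ + n : ℕ) with hU
  have hU0 : ∀ n, u₁ < U n := by
    intro n
    rw [div_lt_iff₀ (by positivity)] at hk₀
    have : (0 : ℝ) ≤ n := n.cast_nonneg
    simp only [hU]
    push_cast
    nlinarith
  have hUs : ∀ n, U (n + 1) = U n + 2 * Real.pi := by
    intro n; simp only [hU]; push_cast; ring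
  have hUm : StrictMono U := strictMono_nat_of_lt_succ fun n => by rw [hUs]; linarith
  have him : StrictMono fun n => (S (U n)).im := fun m n hmn =>
    hS.im_lt_im h (hU0 m).le (hUm hmn)
  -- By the mean value theorem a gap is 2π times the velocity at an intermediate parameter; both gap
  -- bounds follow from this.
  have hgap : ∀ n, ∃ ξ, U n < ξ ∧ ξ < U (n + 1) ∧
      (S (U (n + 1))).im - (S (U n)).im = 2 * Real.pi * (1 / D.phase' (S ξ)).re := by
    intro n
    obtain ⟨ξ, hξ, hξ'⟩ := exists_hasDerivAt_eq_slope (fun u => (S u).im)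
      (fun u => (1 / D.phase' (S u)).re) (hUm n.lt_succ_self)
      (fun u hu => (hS.hasDerivAt_im h ((hU0 n).trans_le hu.1)).continuousAt.continuousWithinAt)
      (fun u hu => hS.hasDerivAt_im h ((hU0 n).trans hu.1))
    refine ⟨ξ, hξ.1, hξ.2, ?_⟩
    rw [hξ', Nat.succ_eq_add_one, hUs]
    field_simp
    ring
  have ht0 : ∀ n, t₀ < (S (U n)).im := fun n => (hS.mem _ (hU0 n).le).2
  have hUp : ∀ n, D.phase (S (U n)) = ((-Real.log ‖a‖ : ℝ) : ℂ) +
      ((-a.arg + 2 * Real.pi * (((k₀ + n : ℕ) : ℤ) : ℝ) : ℝ) : ℂ) * Complex.I := by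
    intro n
    rw [hS.phase_eq _ (hU0 n).le]
    simp only [hU, hc, Int.cast_natCast]
  refine ⟨K, fun n => S (U n), h.K_nonneg, ?_, ?_, ?_, him, ?_, ?_, ?_, ?_, ?_⟩
  · exact h.one_le_t₀.trans (ht0 0).le
  · intro n
    refine ⟨(h.Delta_eq_iff ha (hS.mem _ (hU0 n).le)).mpr ⟨(k₀ + n : ℕ), ?_⟩,
      hS.re_nonneg _ (hU0 n).le, hS.re_le_one _ (hU0 n).le⟩
    exact hUp n
  · intro n
    refine h.multiplicity_eq_one (hS.mem _ (hU0 n).le)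
      ((h.Delta_eq_iff ha (hS.mem _ (hU0 n).le)).mpr ⟨(k₀ + n : ℕ), ?_⟩)
    exact hUp n
  · rintro s ⟨hs1, hs2, hs3⟩ hs4
    have hsm : s ∈ halfStrip t₀ := ⟨⟨by linarith, by linarith⟩, (ht0 0).trans_le hs4⟩
    obtain ⟨k, hk⟩ := (h.Delta_eq_iff ha hsm).mp hs1
    -- A smaller index would mean a lower phase at a point that is not lower than the first one,
    -- against strong monotonicity.
    have hk₀k : (k₀ : ℤ) ≤ k := by
      by_contra hlt
      push Not at hlt
      have h1 := h.strong_mono (hS.mem _ (hU0 0).le) hsm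
      have h2 : D.phase s - D.phase (S (U 0)) =
          ((2 * Real.pi * (k - k₀) : ℝ) : ℂ) * Complex.I := by
        rw [hk, hUp 0]
        push_cast
        ring
      have h3 : (((2 * Real.pi * (k - k₀) : ℝ) : ℂ) * Complex.I *
          (starRingEnd ℂ) (s - S (U 0))).re =
          2 * Real.pi * (k - k₀) * (s.im - (S (U 0)).im) := by
        simp
        ring
      rw [h2, h3] at h1
      have h4 : (k : ℝ) - k₀ < 0 := by
        have : (k : ℝ) < k₀ := by exact_mod_cast hlt
        linarith
      have h5 : 2 * Real.pi * (k - k₀) * (s.im - (S (U 0)).im) ≤ 0 :=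
        mul_nonpos_of_nonpos_of_nonneg (by nlinarith) (by linarith)
      have h6 : ‖s - S (U 0)‖ = 0 := by
        by_contra h7
        have : 0 < ‖s - S (U 0)‖ := lt_of_le_of_ne (norm_nonneg _) (Ne.symm h7)
        have : 0 < (1 + 4 * |c|) * ‖s - S (U 0)‖ ^ 2 := by positivity
        linarith
      rw [norm_eq_zero, sub_eq_zero] at h6
      rw [h6, sub_self] at h2
      have h8 := congrArg Complex.im h2
      simp at h8
      linarith
    obtain ⟨n, hn⟩ := Int.eq_ofNat_of_zero_le (sub_nonneg.mpr hk₀k)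
    refine ⟨n, h.injOn (hS.mem _ (hU0 n).le) hsm ?_⟩
    rw [hUp n, hk]
    have : (k : ℝ) = (((k₀ + n : ℕ) : ℤ) : ℝ) := by
      have : k = ((k₀ + n : ℕ) : ℤ) := by push_cast; linarith
      exact_mod_cast this
    rw [this]
  · refine antitone_nat_of_succ_le fun n => ?_
    -- Concavity at the midpoint of U n and U (n + 2) says exactly that the next gap is not larger.
    have hconc := (hS.concaveOn_im h hd).2 (hU0 n) (hU0 (n + 1 + 1))
      (show (0 : ℝ) ≤ 1 / 2 by norm_num) (show (0 : ℝ) ≤ 1 / 2 by norm_num) (by norm_num)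
    have hmid : (1 / 2 : ℝ) • U n + (1 / 2 : ℝ) • U (n + 1 + 1) = U (n + 1) := by
      rw [hUs (n + 1), hUs n, smul_eq_mul, smul_eq_mul]; ring
    rw [hmid, smul_eq_mul, smul_eq_mul] at hconc
    simp only at hconc ⊢
    linarith
  · intro n
    exact h.one_le_M.trans (h.ell_sub_ge (ht0 n)).1
  · intro n
    obtain ⟨ξ, h1, h2, h3⟩ := hgap n
    have hξ := (hU0 n).trans h1
    have h4 := (h.re_inv_phase'_bounds (hS.mem ξ hξ.le)).2
    have h5 := hS.im_lt_im h (hU0 n).le h1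
    have h6 : 0 < (S (U n)).im := by linarith [ht0 n, h.one_le_t₀]
    have h7 : D.ell (S (U n)).im - K / (S (U n)).im ≤ D.ell (S ξ).im - K / (S ξ).im := by
      have := D.ell_mono hd h6 h5.le
      have := div_le_div_of_nonneg_left h.K_nonneg h6 h5.le
      linarith
    have h8 : 0 < D.ell (S (U n)).im - K / (S (U n)).im := by
      linarith [h.one_le_M, (h.ell_sub_ge (ht0 n)).1]
    rw [h3, mul_assoc]
    have h9 : (1 / D.phase' (S ξ)).re * (D.ell (S (U n)).im - K / (S (U n)).im) ≤ 1 := by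
      rw [← le_div_iff₀ h8]
      exact h4.trans (one_div_le_one_div_of_le h8 h7)
    nlinarith
  · intro n
    obtain ⟨ξ, h1, h2, h3⟩ := hgap n
    have hξ := (hU0 n).trans h1
    have h4 := (h.re_inv_phase'_bounds (hS.mem ξ hξ.le)).1
    have h5 := hS.im_lt_im h hξ.le h2
    have h6 := h.ell_sub_ge (hS.mem ξ hξ.le).2
    have h7 : D.ell (S ξ).im ≤ D.ell (S (U (n + 1))).im :=
      D.ell_mono hd (by linarith [(hS.mem ξ hξ.le).2, h.one_le_t₀]) h5.le
    have h8 : 7 / 8 ≤ (1 / D.phase' (S ξ)).re * D.ell (S ξ).im := by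
      rwa [div_le_iff₀ (by linarith)] at h4
    have h9 : 0 < (1 / D.phase' (S ξ)).re := by
      by_contra h10
      nlinarith
    rw [h3, mul_assoc]
    have h10 : 7 / 8 ≤ (1 / D.phase' (S ξ)).re * D.ell (S (U (n + 1))).im :=
      h8.trans (mul_le_mul_of_nonneg_left h7 h9.le)
    nlinarith [Real.pi_gt_three]

end GammaData

/-! ### The Kusmin-Landau inequality -/

/-- The number `1 / (exp (iθ) - 1)`. -/
noncomputable def kernelCoeff (θ : ℝ) : ℂ :=
  -1 / 2 - Complex.I / 2 * ((Real.cos (θ / 2) / Real.sin (θ / 2) : ℝ) : ℂ)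

lemma kernelCoeff_mul {θ : ℝ} (hθ : Real.sin (θ / 2) ≠ 0) :
    kernelCoeff θ * (Complex.exp (Complex.I * θ) - 1) = 1 := by
  have h1 : Complex.exp (Complex.I * θ) =
      ((Real.cos (θ / 2) : ℂ) + Real.sin (θ / 2) * Complex.I) ^ 2 := by
    rw [Complex.ofReal_cos, Complex.ofReal_sin, ← Complex.exp_mul_I, ← Complex.exp_nat_mul]
    congr 1
    push_cast
    ring
  have h2 : (Real.cos (θ / 2) : ℂ) ^ 2 = 1 - (Real.sin (θ / 2) : ℂ) ^ 2 := by
    exact_mod_cast Real.cos_sq' (θ / 2)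
  have h3 : (Real.sin (θ / 2) : ℂ) ≠ 0 := by exact_mod_cast hθ
  rw [h1, kernelCoeff]
  rw [Complex.ofReal_div]
  generalize (Real.cos (θ / 2) : ℂ) = c at *
  generalize (Real.sin (θ / 2) : ℂ) = s at *
  have hI := Complex.I_sq
  generalize Complex.I = i at *
  have hE : (c + s * i) ^ 2 - 1 = 2 * i * s * (c + s * i) := by
    linear_combination h2 - s ^ 2 * hI
  have hq : c / s * s = c := div_mul_cancel₀ c h3
  rw [hE]
  linear_combination (-i ^ 2 * (c + s * i)) * hq + (-s ^ 2 - c ^ 2 - i * c * s) * hI + h2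

lemma div_pi_le_sin {θ δ : ℝ} (hδ : 0 < δ) (h1 : δ ≤ θ) (h2 : θ ≤ 2 * Real.pi - δ) :
    δ / Real.pi ≤ Real.sin (θ / 2) := by
  have hpi := Real.pi_pos
  rcases le_total θ Real.pi with h | h
  · have h3 := Real.mul_le_sin (x := θ / 2) (by linarith) (by linarith)
    refine le_trans ?_ h3
    rw [div_le_iff₀ hpi]
    have : 2 / Real.pi * (θ / 2) * Real.pi = θ := by field_simp
    linarith
  · have h3 := Real.mul_le_sin (x := Real.pi - θ / 2) (by linarith) (by linarith)
    rw [Real.sin_pi_sub] at h3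
    refine le_trans ?_ h3
    rw [div_le_iff₀ hpi]
    have : 2 / Real.pi * (Real.pi - θ / 2) * Real.pi = 2 * Real.pi - θ := by field_simp
    linarith

lemma norm_kernelCoeff_le {θ δ : ℝ} (hδ : 0 < δ) (h1 : δ ≤ θ) (h2 : θ ≤ 2 * Real.pi - δ) :
    ‖kernelCoeff θ‖ ≤ 1 / 2 + Real.pi / (2 * δ) ∧
      |Real.cos (θ / 2) / Real.sin (θ / 2)| ≤ Real.pi / δ := by
  have hpi := Real.pi_pos
  have hs := div_pi_le_sin hδ h1 h2
  have hs0 : 0 < δ / Real.pi := by positivity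
  have hcot : |Real.cos (θ / 2) / Real.sin (θ / 2)| ≤ Real.pi / δ := by
    rw [abs_div, abs_of_pos (hs0.trans_le hs), div_le_iff₀ (hs0.trans_le hs)]
    have h3 : Real.pi / δ * (δ / Real.pi) = 1 := by field_simp
    have h4 := mul_le_mul_of_nonneg_left hs (show 0 ≤ Real.pi / δ by positivity)
    linarith [Real.abs_cos_le_one (θ / 2)]
  refine ⟨(norm_sub_le _ _).trans ?_, hcot⟩
  rw [norm_mul, Complex.norm_real, Real.norm_eq_abs]
  have h5 : Real.pi / (2 * δ) = 1 / 2 * (Real.pi / δ) := by field_simp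
  rw [h5]
  have h6 : ‖(-1 / 2 : ℂ)‖ = 1 / 2 := by norm_num
  have h7 : ‖Complex.I / 2‖ = 1 / 2 := by simp
  rw [h6, h7]
  linarith

lemma cot_sub_cot_nonneg {a b : ℝ} (ha : 0 < Real.sin a) (hb : 0 < Real.sin b)
    (h : 0 ≤ b - a) (hpi : b - a ≤ Real.pi) :
    0 ≤ Real.cos a / Real.sin a - Real.cos b / Real.sin b := by
  have h1 : Real.cos a / Real.sin a - Real.cos b / Real.sin b =
      Real.sin (b - a) / (Real.sin a * Real.sin b) := by
    rw [Real.sin_sub]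
    field_simp
  rw [h1]
  exact div_nonneg (Real.sin_nonneg_of_nonneg_of_le_pi h hpi) (mul_pos ha hb).le

/-- The **Kusmin-Landau inequality** for decreasing differences. -/
theorem norm_sum_exp_le_of_antitone {g : ℕ → ℝ} (hg : Antitone fun n => g (n + 1) - g n)
    {δ : ℝ} (hδ : 0 < δ) {N : ℕ} (h0 : g 1 - g 0 ≤ 2 * Real.pi - δ) (hN : δ ≤ g (N + 1) - g N) :
    ‖∑ n ∈ Finset.range N, Complex.exp (Complex.I * g n)‖ ≤ 1 + 2 * Real.pi / δ := by
  have hpi := Real.pi_pos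
  set θ : ℕ → ℝ := fun n => g (n + 1) - g n with hθ
  set z : ℕ → ℂ := fun n => Complex.exp (Complex.I * g n) with hz
  have hz1 : ∀ n, ‖z n‖ = 1 := fun n => by
    simp only [hz]; rw [mul_comm]; exact Complex.norm_exp_ofReal_mul_I _
  have hlo : ∀ n ≤ N, δ ≤ θ n := fun n hn => hN.trans (hg hn)
  have hhi : ∀ n, θ n ≤ 2 * Real.pi - δ := fun n => (hg n.zero_le).trans h0
  have hsin : ∀ n ≤ N, 0 < Real.sin (θ n / 2) := fun n hn =>
    (show 0 < δ / Real.pi by positivity).trans_le (div_pi_le_sin hδ (hlo n hn) (hhi n))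
  -- Each term is (z (n + 1) - z n)/(exp(iθ n) - 1), which prepares a summation by parts.
  have hstep : ∀ n ≤ N, z n + z n * kernelCoeff (θ n) = z (n + 1) * kernelCoeff (θ n) := by
    intro n hn
    have h1 := kernelCoeff_mul (hsin n hn).ne'
    have h2 : z (n + 1) = z n * Complex.exp (Complex.I * θ n) := by
      simp only [hz, hθ]
      rw [← Complex.exp_add]
      congr 1
      push_cast
      ring
    rw [h2]
    linear_combination (-z n) * h1
  -- The kernel varies only through cot(θ/2)/2, which is monotone along the sequence, so its total
  -- variation telescopes.
  have hmain : ∀ n ≤ N, ‖∑ k ∈ Finset.range n, z k - z n * kernelCoeff (θ n) +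
      z 0 * kernelCoeff (θ 0)‖ ≤ 1 / 2 * (Real.cos (θ n / 2) / Real.sin (θ n / 2) -
        Real.cos (θ 0 / 2) / Real.sin (θ 0 / 2)) := by
    intro n
    induction n with
    | zero => intro _; simp
    | succ n ih =>
      intro hn
      have ih' := ih (by omega)
      have h1 := hstep n (by omega)
      have h2 : ∑ k ∈ Finset.range (n + 1), z k - z (n + 1) * kernelCoeff (θ (n + 1)) +
          z 0 * kernelCoeff (θ 0) = (∑ k ∈ Finset.range n, z k - z n * kernelCoeff (θ n) +
          z 0 * kernelCoeff (θ 0)) +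
          z (n + 1) * (kernelCoeff (θ n) - kernelCoeff (θ (n + 1))) := by
        rw [Finset.sum_range_succ]
        linear_combination h1
      have h3 := cot_sub_cot_nonneg (hsin (n + 1) hn) (hsin n (by omega))
        (by linarith [hg n.le_succ]) (by linarith [hhi n, hlo (n + 1) hn])
      have h4 : ‖kernelCoeff (θ n) - kernelCoeff (θ (n + 1))‖ = 1 / 2 *
          (Real.cos (θ (n + 1) / 2) / Real.sin (θ (n + 1) / 2) -
            Real.cos (θ n / 2) / Real.sin (θ n / 2)) := by
        have h5 : kernelCoeff (θ n) - kernelCoeff (θ (n + 1)) = Complex.I / 2 *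
          ((Real.cos (θ (n + 1) / 2) / Real.sin (θ (n + 1) / 2) -
            Real.cos (θ n / 2) / Real.sin (θ n / 2) : ℝ) : ℂ) := by
          unfold kernelCoeff; push_cast; ring
        rw [h5, norm_mul, Complex.norm_real, Real.norm_of_nonneg h3]
        simp
      rw [h2]
      refine (norm_add_le _ _).trans ?_
      rw [norm_mul, hz1, h4]
      linarith
  have h6 := hmain N le_rfl
  obtain ⟨h7, h8⟩ := norm_kernelCoeff_le hδ (hlo N le_rfl) (hhi N)
  obtain ⟨h9, h10⟩ := norm_kernelCoeff_le hδ (hlo 0 N.zero_le) (hhi 0)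
  have h11 : ∑ k ∈ Finset.range N, z k = (∑ k ∈ Finset.range N, z k - z N * kernelCoeff (θ N) +
      z 0 * kernelCoeff (θ 0)) + (z N * kernelCoeff (θ N) - z 0 * kernelCoeff (θ 0)) := by ring
  rw [h11]
  refine (norm_add_le _ _).trans ?_
  have h12 : ‖z N * kernelCoeff (θ N) - z 0 * kernelCoeff (θ 0)‖ ≤
      (1 / 2 + Real.pi / (2 * δ)) + (1 / 2 + Real.pi / (2 * δ)) := by
    refine (norm_sub_le _ _).trans ?_
    rw [norm_mul, norm_mul, hz1, hz1]
    linarith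
  have h13 : Real.pi / (2 * δ) = 1 / 2 * (Real.pi / δ) := by field_simp
  have h14 : 2 * Real.pi / δ = 2 * (Real.pi / δ) := by ring
  rw [h13] at h12
  rw [h14]
  linarith [(abs_le.mp h8).2, (abs_le.mp h10).1]

lemma natCast_mul_le_sub {g : ℕ → ℝ} (m k : ℕ) {h : ℝ}
    (hh : ∀ n < m + k, h ≤ g (n + 1) - g n) : k * h ≤ g (m + k) - g m := by
  induction k with
  | zero => simp
  | succ k ih =>
    have h1 := ih fun n hn => hh n (by omega)
    have h2 := hh (m + k) (by omega)
    push_cast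
    rw [← add_assoc]
    linarith

/-! ### Exponential sums over a block of ordinates -/

namespace GammaData

variable {D : GammaData} {a : ℂ} {K : ℝ} {p : ℕ → ℂ}

namespace IsPointSequence

variable (hp : D.IsPointSequence a K p)
include hp

lemma one_le_im' (n : ℕ) : 1 ≤ (p n).im :=
  hp.one_le_im.trans (hp.strictMono.monotone n.zero_le)

lemma gap_pos (n : ℕ) : 0 < (p (n + 1)).im - (p n).im :=
  sub_pos.mpr (hp.strictMono n.lt_succ_self)

lemma one_le_ell (n : ℕ) : 1 ≤ D.ell (p n).im := by
  have h1 := hp.one_le_ell_sub n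
  have h2 : 0 ≤ K / (p n).im := div_nonneg hp.K_nonneg (by linarith [hp.one_le_im' n])
  linarith

lemma gap_le_two_pi (n : ℕ) : (p (n + 1)).im - (p n).im ≤ 2 * Real.pi := by
  have h1 := hp.gap_le n
  have h2 := hp.one_le_ell_sub n
  have h3 := hp.gap_pos n
  nlinarith

/-- Ordinates bounded by B would have gaps at least 1/ℓ(B), so they would pass B after finitely many
steps. -/
lemma exists_im_gt (hd : 0 < D.degree) (B : ℝ) : ∃ n, B < (p n).im := by
  by_contra! hB
  have hB1 : 1 ≤ B := hp.one_le_im.trans (hB 0)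
  have hell : 1 ≤ D.ell B :=
    (hp.one_le_ell 0).trans (D.ell_mono hd (by linarith [hp.one_le_im]) (hB 0))
  obtain ⟨k, hk⟩ := exists_nat_gt (B * D.ell B)
  have h1 : ∀ n < 0 + k, 1 / D.ell B ≤ (p (n + 1)).im - (p n).im := by
    intro n _
    rw [div_le_iff₀ (by linarith)]
    refine (hp.one_le_gap n).trans (mul_le_mul_of_nonneg_left ?_ (hp.gap_pos n).le)
    exact D.ell_mono hd (by linarith [hp.one_le_im' (n + 1)]) (hB _)
  have h2 := natCast_mul_le_sub (g := fun n => (p n).im) 0 k h1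
  rw [zero_add, mul_one_div, div_le_iff₀ (by linarith)] at h2
  have h3 := hp.one_le_im
  have h4 := hB k
  nlinarith

lemma tendsto_im (hd : 0 < D.degree) : Tendsto (fun n => (p n).im) atTop atTop :=
  tendsto_atTop_atTop_of_monotone hp.strictMono.monotone fun B =>
    (hp.exists_im_gt hd B).imp fun _ h => h.le

/-- The estimate for exponential sums over a block of ordinates. -/
theorem norm_sum_Ico_le (hd : 0 < D.degree) : ∃ T₀ C : ℝ, 0 ≤ C ∧ ∀ T, T₀ ≤ T →
    ∀ X : ℝ, 0 < X → ∀ y : ℝ, 2 ≤ y → X ≤ D.ell T - 1 / y → ∀ m N : ℕ,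
    (∀ n, m ≤ n → T < (p n).im) → (∀ n < N, (p n).im ≤ 2 * T) →
    ‖∑ n ∈ Finset.Ico m N, Complex.exp (Complex.I * ((X * (p n).im : ℝ) : ℂ))‖ ≤
      C * (Real.log T / X + y * X) := by
  set A := |Real.log (D.lamProd * D.Q ^ 2)| + D.degree with hA
  have hA0 : 0 < A := by positivity
  have hK := hp.K_nonneg
  obtain ⟨T₁, hT₁⟩ := eventually_atTop.mp ((D.tendsto_ell hd).eventually_ge_atTop
    (1 + D.degree * Real.log 3))
  -- T₁ gives ℓ(3T) ≤ 2ℓ(T); 13 > 4π leaves room for two more gaps between 2T and 3T and gives log T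
  -- ≥ 1; 4K gives K/T ≤ 1/4.
  refine ⟨max T₁ (max (p 0).im (max 13 (4 * K))), 16 * A + 16 * K + 4, by positivity, ?_⟩
  intro T hT X hX y hy hXy m N hm hN
  simp only [max_le_iff] at hT
  obtain ⟨hTT, hTp, hT13, hTK⟩ := hT
  have hpi3 := Real.pi_gt_three
  have hpi4 := Real.pi_lt_d2
  have hlog3 : 0 < Real.log 3 := Real.log_pos (by norm_num)
  have hlogT : 1 ≤ Real.log T := by
    rw [Real.le_log_iff_exp_le (by linarith)]
    linarith [Real.exp_one_lt_d9]
  set L := D.ell T with hL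
  have hL1 : 1 ≤ L := by have := hT₁ T hTT; nlinarith
  have hLA : L ≤ A * Real.log T := by
    rw [hL, ell, hA]
    have h1 := le_abs_self (Real.log (D.lamProd * D.Q ^ 2))
    have h2 := abs_nonneg (Real.log (D.lamProd * D.Q ^ 2))
    nlinarith
  have hL3 : D.ell (3 * T) ≤ 2 * L := by
    have h1 : D.ell (3 * T) = D.degree * Real.log 3 + L := by
      rw [hL, ell, ell, Real.log_mul (show (3 : ℝ) ≠ 0 by norm_num) (show T ≠ 0 by linarith)]; ring
    have := hT₁ T hTT
    linarith
  have hfrac : 0 ≤ Real.log T / X := by positivity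
  have hyX : 0 < y * X := by positivity
  have hC : 0 ≤ 16 * A + 16 * K + 4 := by positivity
  rcases le_or_gt N m with hNm | hNm
  · rw [Finset.Ico_eq_empty_of_le hNm, Finset.sum_empty, norm_zero]
    positivity
  -- The smallest gap needed, just past the block; its ordinates are still at most 2T + 4π ≤ 3T.
  have hgapN : 1 / (2 * L) ≤ (p (N + 1)).im - (p N).im := by
    have h1 : (p (N - 1)).im ≤ 2 * T := hN _ (by omega)
    have h2 := hp.gap_le_two_pi (N - 1)
    have h3 := hp.gap_le_two_pi N
    rw [Nat.sub_add_cancel (by omega)] at h2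
    have h4 : D.ell (p (N + 1)).im ≤ 2 * L :=
      (D.ell_mono hd (by linarith [hp.one_le_im' (N + 1)]) (by linarith)).trans hL3
    rw [div_le_iff₀ (by linarith)]
    exact (hp.one_le_gap N).trans (mul_le_mul_of_nonneg_left h4 (hp.gap_pos N).le)
  -- 2π/W bounds the first and largest gap of the block.
  set W := L - K / T with hW
  have hKT : K / T ≤ 1 / 4 := by rw [div_le_iff₀ (by linarith)]; linarith
  have hKT0 : 0 ≤ K / T := by positivity
  have hW0 : 0 < W := by linarith
  have hgapm : ((p (m + 1)).im - (p m).im) * W ≤ 2 * Real.pi := by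
    have h1 := hm m le_rfl
    have h2 : W ≤ D.ell (p m).im - K / (p m).im := by
      have h3 := D.ell_mono hd (by linarith) h1.le
      have h4 := div_le_div_of_nonneg_left hK (by linarith) h1.le
      linarith
    exact (mul_le_mul_of_nonneg_left h2 (hp.gap_pos m).le).trans (hp.gap_le m)
  have hKL : X < W → ‖∑ n ∈ Finset.Ico m N, Complex.exp (Complex.I * ((X * (p n).im : ℝ) : ℂ))‖ ≤
      1 + 4 * Real.pi * (L / X) + W / (W - X) := by
    intro hXW
    -- The differences X·gap are at least X/(2L) and at most 2πX/W = 2π - 2π(W - X)/W.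
    set δ := min (X / (2 * L)) (2 * Real.pi * (W - X) / W) with hδ
    have hδ1 : 0 < X / (2 * L) := by positivity
    have hδ2 : 0 < 2 * Real.pi * (W - X) / W :=
      div_pos (mul_pos (by positivity) (by linarith)) hW0
    have hδ0 : 0 < δ := lt_min hδ1 hδ2
    rw [Finset.sum_Ico_eq_sum_range]
    have h1 := norm_sum_exp_le_of_antitone (g := fun n => X * (p (m + n)).im) (δ := δ) (N := N - m)
      (fun i j hij => by
        have := hp.gap_antitone (show m + i ≤ m + j by omega)
        simp only [← add_assoc] at this ⊢
        nlinarith) hδ0 (by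
        have h2 : ((p (m + 1)).im - (p m).im) ≤ 2 * Real.pi / W := by rwa [le_div_iff₀ hW0]
        have h3 := min_le_right (X / (2 * L)) (2 * Real.pi * (W - X) / W)
        have h4 : 2 * Real.pi * (W - X) / W = 2 * Real.pi - X * (2 * Real.pi / W) := by
          field_simp
        have h5 := mul_le_mul_of_nonneg_left h2 hX.le
        simp only [add_zero]
        linarith) (by
        have h2 := min_le_left (X / (2 * L)) (2 * Real.pi * (W - X) / W)
        have h3 := mul_le_mul_of_nonneg_left hgapN hX.le
        have h4 : X * (1 / (2 * L)) = X / (2 * L) := by ring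
        have h5 : m + (N - m) = N := by omega
        simp only [← add_assoc]
        rw [h5]
        linarith)
    refine h1.trans ?_
    have h6 : 2 * Real.pi / δ ≤ 2 * Real.pi / (X / (2 * L)) + 2 * Real.pi /
        (2 * Real.pi * (W - X) / W) := by
      have h7 : 0 < 2 * Real.pi / (X / (2 * L)) := by positivity
      have h8 : 0 < 2 * Real.pi / (2 * Real.pi * (W - X) / W) := by positivity
      rcases min_choice (X / (2 * L)) (2 * Real.pi * (W - X) / W) with h9 | h9
      · rw [hδ, h9]; linarith
      · rw [hδ, h9]; linarith
    have h10 : 2 * Real.pi / (X / (2 * L)) = 4 * Real.pi * (L / X) := by field_simp; norm_num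
    have h11 : 2 * Real.pi / (2 * Real.pi * (W - X) / W) = W / (W - X) := by
      have : W - X ≠ 0 := by linarith
      field_simp
    rw [h10, h11] at h6
    linarith
  have hLX : L / X ≤ A * (Real.log T / X) := by
    rw [← mul_div_assoc]; exact div_le_div_of_nonneg_right hLA hX.le
  have hLX0 : 0 < L / X := by positivity
  have hexpand : (16 * A + 16 * K + 4) * (Real.log T / X + y * X) = 16 * (A * (Real.log T / X)) +
      16 * (K * (Real.log T / X)) + 4 * (Real.log T / X) +
      (16 * A + 16 * K + 4) * (y * X) := by ring
  -- For X ≤ L/2 the upper margin is harmless: W/(W - X) ≤ 4.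
  rcases le_or_gt X (L / 2) with hXL | hXL
  · refine (hKL (by linarith)).trans ?_
    have h1 : W / (W - X) ≤ 4 := by
      rw [div_le_iff₀ (by linarith)]; linarith
    have h2 : 2 ≤ L / X := by rw [le_div_iff₀ hX]; linarith
    have h3 : 4 * Real.pi * (L / X) ≤ 4 * 3.15 * (L / X) :=
      mul_le_mul_of_nonneg_right (by linarith) hLX0.le
    have h4 : 0 ≤ K * (Real.log T / X) := by positivity
    have h5 : 0 ≤ (16 * A + 16 * K + 4) * (y * X) := by positivity
    rw [hexpand]
    linarith
  -- Half of the margin 1/y absorbs the error K/T, leaving W - X ≥ 1/(2y).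
  rcases le_or_gt (K / T) (1 / (2 * y)) with hKy | hKy
  · have hy0 : 0 < 1 / (2 * y) := by positivity
    have hyy : 1 / y = 1 / (2 * y) + 1 / (2 * y) := by field_simp; norm_num
    have hgap : 1 / (2 * y) ≤ W - X := by linarith
    refine (hKL (by linarith)).trans ?_
    have h1 : W / (W - X) ≤ 4 * (y * X) := by
      rw [div_le_iff₀ (by linarith)]
      have h2 := mul_le_mul_of_nonneg_left hgap (show 0 ≤ 4 * (y * X) by positivity)
      have h3 : 4 * (y * X) * (1 / (2 * y)) = 2 * X := by field_simp; norm_num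
      linarith
    have h2 : 1 ≤ L / X := by
      have : 0 < 1 / y := by positivity
      rw [le_div_iff₀ hX]; linarith
    have h3 : 4 * Real.pi * (L / X) ≤ 4 * 3.15 * (L / X) :=
      mul_le_mul_of_nonneg_right (by linarith) hLX0.le
    have h4 : 0 ≤ K * (Real.log T / X) := by positivity
    have h5 : 0 ≤ (16 * A + 16 * K) * (y * X) := by positivity
    rw [hexpand]
    linarith
  -- Otherwise T is at most 2Ky, and the trivial bound suffices: there are at most 4LT terms, and L
  -- < 2X.
  · have h1 : T ≤ 2 * K * y := by
      rw [div_lt_div_iff₀ (by positivity) (by linarith)] at hKy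
      linarith
    have h2 : ‖∑ n ∈ Finset.Ico m N, Complex.exp (Complex.I * ((X * (p n).im : ℝ) : ℂ))‖ ≤
        (N - m : ℕ) := by
      refine (norm_sum_le _ _).trans (le_of_eq ?_)
      simp_rw [mul_comm Complex.I, Complex.norm_exp_ofReal_mul_I]
      simp
    have h3 := natCast_mul_le_sub (g := fun n => (p n).im) m (N - m) (h := 1 / (2 * L))
      (fun n hn => hgapN.trans (hp.gap_antitone (by omega)))
    rw [show m + (N - m) = N by omega, mul_one_div, div_le_iff₀ (by linarith)] at h3
    have h4 : (p N).im ≤ 3 * T := by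
      have h5 : (p (N - 1)).im ≤ 2 * T := hN _ (by omega)
      have h6 := hp.gap_le_two_pi (N - 1)
      rw [Nat.sub_add_cancel (by omega)] at h6
      linarith
    have h5 := hm m le_rfl
    have h6 : ((N - m : ℕ) : ℝ) ≤ 4 * L * T := by nlinarith
    have h7 : 4 * L * T ≤ 4 * (2 * X) * (2 * K * y) :=
      mul_le_mul (by linarith) h1 (by linarith) (by positivity)
    have h8 : 0 ≤ (16 * A + 16 * K + 4) * (Real.log T / X) := by positivity
    have h9 : 0 ≤ (16 * A + 4) * (y * X) := by positivity
    have h10 : 4 * (2 * X) * (2 * K * y) = 16 * K * (y * X) := by ring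
    linarith

end IsPointSequence

end GammaData

/-! ### The bound for the sum over a-points -/

namespace GammaData

variable {D : GammaData} {a : ℂ} {K : ℝ} {p : ℕ → ℂ}

lemma lamProd_pos (D : GammaData) : 0 < D.lamProd :=
  Finset.prod_pos fun j _ => Real.rpow_pos_of_pos (D.lam_pos j) _

lemma exp_ell (D : GammaData) {t : ℝ} (ht : 0 < t) :
    Real.exp (D.ell t) = D.lamProd * D.Q ^ 2 * t ^ D.degree := by
  rw [ell, Real.exp_add, Real.exp_log (mul_pos D.lamProd_pos (pow_pos D.Q_pos 2)),
    Real.rpow_def_of_pos ht, mul_comm D.degree]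

/-- Conjugation reverses the sign of the frequency; this reduces x < 1 to positive log. -/
lemma norm_sum_exp_abs (s : Finset ℕ) (L : ℝ) (g : ℕ → ℝ) :
    ‖∑ n ∈ s, Complex.exp (Complex.I * ((L * g n : ℝ) : ℂ))‖ =
      ‖∑ n ∈ s, Complex.exp (Complex.I * ((|L| * g n : ℝ) : ℂ))‖ := by
  rcases abs_choice L with h | h
  · rw [h]
  · rw [h, ← RCLike.norm_conj, map_sum]
    congr 1
    refine Finset.sum_congr rfl fun n _ => ?_
    rw [← Complex.exp_conj, map_mul, Complex.conj_I, Complex.conj_ofReal]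
    congr 1
    push_cast
    ring

lemma abs_log_le_of_max_le {x B : ℝ} (hx : 0 < x) (hB : max x (1 / x) ≤ B) :
    |Real.log x| ≤ Real.log B := by
  rw [max_le_iff] at hB
  have h1 := Real.log_le_log hx hB.1
  have h2 := Real.log_le_log (by positivity) hB.2
  rw [one_div, Real.log_inv] at h2
  exact abs_le.mpr ⟨by linarith, h1⟩

namespace IsPointSequence

variable (hp : D.IsPointSequence a K p)
include hp

lemma injective : Function.Injective p := fun _ _ hmn =>
  hp.strictMono.injective (congrArg Complex.im hmn)

lemma exists_pointsBetween_eq (hd : 0 < D.degree) {T : ℝ} (hT : (p 0).im ≤ T) (T' : ℝ) :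
    ∃ m N : ℕ, (∀ n, m ≤ n → T < (p n).im) ∧ (∀ n < N, (p n).im ≤ T') ∧
      D.pointsBetween a T T' = p '' (Finset.Ico m N : Finset ℕ) := by
  classical
  refine ⟨Nat.find (hp.exists_im_gt hd T), Nat.find (hp.exists_im_gt hd T'), ?_, ?_, ?_⟩
  · exact fun n hn => (Nat.find_spec (hp.exists_im_gt hd T)).trans_le (hp.strictMono.monotone hn)
  · exact fun n hn => not_lt.mp (Nat.find_min _ hn)
  · ext s
    constructor
    · rintro ⟨h1, h2, h3⟩
      obtain ⟨n, rfl⟩ := hp.surj s h1 (by linarith)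
      refine ⟨n, ?_, rfl⟩
      rw [Finset.coe_Ico]
      refine ⟨Nat.find_min' _ h2, ?_⟩
      by_contra h4
      have h5 := (Nat.find_spec (hp.exists_im_gt hd T')).trans_le
        (hp.strictMono.monotone (not_lt.mp h4))
      exact absurd h3 (not_le.mpr h5)
    · rintro ⟨n, hn, rfl⟩
      rw [Finset.coe_Ico] at hn
      exact ⟨hp.mem n, (Nat.find_spec (hp.exists_im_gt hd T)).trans_le
        (hp.strictMono.monotone hn.1), not_lt.mp (Nat.find_min _ hn.2)⟩

/-- The bound for the sum over the ordinates of the nontrivial `a`-points. -/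
theorem ordinateSum_bound (hd : 0 < D.degree) {y : ℝ → ℝ} (hy : ∀ᶠ t in atTop, 2 ≤ y t) :
    ∃ T₀ C : ℝ, 0 < T₀ ∧ ∀ T : ℝ, T₀ ≤ T → ∀ x : ℝ, 0 < x → x ≠ 1 →
      max x (1 / x) ≤ (1 - 1 / y T) * (D.lamProd * D.Q ^ 2 * T ^ D.degree) →
      (D.pointsBetween a T (2 * T)).Finite ∧
      ‖D.ordinateSum a x T (2 * T)‖ ≤
        C * ((1 + |Real.log x|) *
          (Real.log T / |Real.log x| + psi T + y T * |Real.log x|)) := by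
  obtain ⟨T₁, C, hC, hmain⟩ := hp.norm_sum_Ico_le hd
  obtain ⟨T₂, hT₂⟩ := eventually_atTop.mp hy
  refine ⟨max (max T₁ T₂) (max (p 0).im (Real.exp 1)), C,
    (Real.exp_pos 1).trans_le ((le_max_right _ _).trans (le_max_right _ _)), ?_⟩
  intro T hT x hx hx1 hxT
  simp only [max_le_iff] at hT
  obtain ⟨⟨hT1, hT2⟩, hTp, hTe⟩ := hT
  have hT0 : 0 < T := (Real.exp_pos 1).trans_le hTe
  have hy2 := hT₂ T hT2
  obtain ⟨m, N, hm, hN, hset⟩ := hp.exists_pointsBetween_eq hd hTp (2 * T)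
  have hlogT : 1 ≤ Real.log T := by rwa [Real.le_log_iff_exp_le hT0]
  have hX : 0 < |Real.log x| := by
    rw [abs_pos]
    intro h
    rcases Real.log_eq_zero.mp h with h | h | h
    · exact hx.ne' h
    · exact hx1 h
    · linarith
  -- Taking logarithms of the condition on x, with log(1 - 1/y) ≤ -1/y.
  have hXy : |Real.log x| ≤ D.ell T - 1 / y T := by
    have h1 := abs_log_le_of_max_le hx hxT
    have h2 : 0 < 1 - 1 / y T := by
      rw [sub_pos, div_lt_one (by linarith)]; linarith
    rw [← D.exp_ell hT0, Real.log_mul h2.ne' (Real.exp_ne_zero _), Real.log_exp] at h1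
    have h3 := Real.log_le_sub_one_of_pos h2
    linarith
  refine ⟨hset ▸ (Finset.finite_toSet _).image p, ?_⟩
  have hsum : D.ordinateSum a x T (2 * T) = ∑ n ∈ Finset.Ico m N,
      Complex.exp (Complex.I * ((Real.log x * (p n).im : ℝ) : ℂ)) := by
    rw [ordinateSum, hset, finsum_mem_image hp.injective.injOn, finsum_mem_coe_finset]
    refine Finset.sum_congr rfl fun n _ => ?_
    rw [hp.multiplicity_eq, Complex.cpow_def_of_ne_zero (by exact_mod_cast hx.ne'),
      ← Complex.ofReal_log hx.le]
    simp only [ENat.toNat_one, Nat.cast_one, one_mul]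
    congr 1
    push_cast
    ring
  rw [hsum, norm_sum_exp_abs]
  refine (hmain T hT1 _ hX (y T) hy2 hXy m N hm hN).trans (mul_le_mul_of_nonneg_left ?_ hC)
  -- At T = e the denominator log log T is 0 and the quotient takes the value 0. The terms ψ(T) and
  -- |log x| in the stated bound only enlarge what has been proved.
  have hpsi : 0 ≤ psi T := div_nonneg (by linarith) (Real.log_nonneg hlogT)
  have h1 : 0 ≤ Real.log T / |Real.log x| + y T * |Real.log x| := by
    have : 0 ≤ y T := by linarith
    have : 0 ≤ Real.log T := by linarith
    positivity
  nlinarith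

end IsPointSequence

end GammaData

/-! ### Fejér's criterion for uniform distribution -/

/-- Clamping to `[b, c]`, normalized to vanish below `b`. -/
noncomputable def clampLength (b c t : ℝ) : ℝ := max b (min t c) - b

/-- The measure of the points in `[0, t]` with fractional part in `[b, c]`. -/
noncomputable def hitLength (b c t : ℝ) : ℝ := ⌊t⌋ * (c - b) + clampLength b c (Int.fract t)

/-- A counting function of the boundary points of the set of points with fractional part
in `[b, c]`. -/
noncomputable def jumpCount (b c t : ℝ) : ℤ := ⌊t⌋ + ⌊t - b⌋ + ⌈t - c⌉

open Classical in
/-- The indicator function of the points with fractional part in `[b, c]`. -/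
noncomputable def hitIndicator (b c t : ℝ) : ℝ := if Int.fract t ∈ Set.Icc b c then 1 else 0

section

variable {b c : ℝ}

lemma clampLength_mono {s t : ℝ} (hst : s ≤ t) : clampLength b c s ≤ clampLength b c t :=
  sub_le_sub_right (max_le_max le_rfl (min_le_min hst le_rfl)) _

lemma clampLength_sub_le {s t : ℝ} (hst : s ≤ t) :
    clampLength b c t - clampLength b c s ≤ t - s := by
  unfold clampLength
  rcases max_cases b (min t c) with h | h <;> rcases max_cases b (min s c) with h' | h' <;>
    rcases min_cases t c with h2 | h2 <;> rcases min_cases s c with h3 | h3 <;> linarith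

lemma clampLength_mem (hbc : b ≤ c) (t : ℝ) : 0 ≤ clampLength b c t ∧ clampLength b c t ≤ c - b := by
  unfold clampLength
  constructor
  · linarith [le_max_left b (min t c)]
  · linarith [max_le hbc (min_le_right t c)]

lemma hitLength_sub_mem (hb : 0 ≤ b) (hbc : b ≤ c) (hc : c ≤ 1) {s t : ℝ} (hst : s ≤ t) :
    0 ≤ hitLength b c t - hitLength b c s ∧ hitLength b c t - hitLength b c s ≤ t - s := by
  have hs := Int.floor_add_fract s
  have ht := Int.floor_add_fract t
  have hs1 := (Int.fract_lt_one s).le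
  have ht0 := Int.fract_nonneg t
  rcases eq_or_lt_of_le (Int.floor_mono hst) with h | h
  · have hf : Int.fract s ≤ Int.fract t := by
      rw [← Int.self_sub_floor, ← Int.self_sub_floor, h]; linarith
    have h1 := clampLength_mono (b := b) (c := c) hf
    have h2 := clampLength_sub_le (b := b) (c := c) hf
    unfold hitLength
    rw [h] at hs ⊢
    constructor <;> linarith
  · have hk : (⌊s⌋ : ℝ) + 1 ≤ ⌊t⌋ := by exact_mod_cast h
    have h1 : clampLength b c 1 = c - b := by
      rw [clampLength, min_eq_right hc, max_eq_right hbc]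
    have h0 : clampLength b c 0 = 0 := by
      rw [clampLength, min_eq_left (hb.trans hbc), max_eq_left hb, sub_self]
    have h2 := clampLength_mono (b := b) (c := c) hs1
    have h3 := clampLength_sub_le (b := b) (c := c) hs1
    have h4 := clampLength_mono (b := b) (c := c) ht0
    have h5 := clampLength_sub_le (b := b) (c := c) ht0
    unfold hitLength
    constructor <;> nlinarith

/-- The difference depends only on the fractional part of t, so it stays bounded. -/
lemma abs_hitLength_sub_le (hb : 0 ≤ b) (hbc : b ≤ c) (hc : c ≤ 1) (t : ℝ) :
    |hitLength b c t - (c - b) * t| ≤ 1 := by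
  have ht := Int.floor_add_fract t
  have h0 := Int.fract_nonneg t
  have h1 := (Int.fract_lt_one t).le
  have h2 := clampLength_mem hbc (Int.fract t)
  have h3 : hitLength b c t - (c - b) * t =
      clampLength b c (Int.fract t) - (c - b) * Int.fract t := by
    unfold hitLength
    linear_combination (c - b) * ht
  rw [h3, abs_le]
  constructor <;> nlinarith

lemma jumpCount_mono : Monotone (jumpCount b c) := fun _ _ h =>
  add_le_add (add_le_add (Int.floor_mono h) (Int.floor_mono (sub_le_sub_right h _)))
    (Int.ceil_mono (sub_le_sub_right h _))

lemma abs_jumpCount_sub_le (s t : ℝ) :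
    |((jumpCount b c t : ℤ) : ℝ) - (jumpCount b c s : ℤ)| ≤ 3 * |t - s| + 3 := by
  wlog hst : s ≤ t generalizing s t
  · rw [abs_sub_comm, abs_sub_comm t]; exact this t s (le_of_not_ge hst)
  have h0 : ((jumpCount b c s : ℤ) : ℝ) ≤ (jumpCount b c t : ℤ) := by
    exact_mod_cast jumpCount_mono hst
  rw [abs_of_nonneg (sub_nonneg.mpr h0), abs_of_nonneg (sub_nonneg.mpr hst)]
  unfold jumpCount
  push_cast
  linarith [Int.floor_le t, Int.lt_floor_add_one s, Int.floor_le (t - b),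
    Int.lt_floor_add_one (s - b), Int.ceil_lt_add_one (t - c), Int.le_ceil (s - c)]

/-- The three integer parts are monotone, so equality of their sum forces equality of each. Then s
and t lie in the same unit cell on the same side of b and c; the ceiling keeps c itself inside the
closed interval. -/
lemma hitLength_sub_of_jumpCount_eq {s t : ℝ}
    (h : jumpCount b c s = jumpCount b c t) :
    hitLength b c t - hitLength b c s = hitIndicator b c s * (t - s) := by
  have hfl : ⌊s⌋ = ⌊t⌋ ∧ ⌊s - b⌋ = ⌊t - b⌋ ∧ ⌈s - c⌉ = ⌈t - c⌉ := by
    unfold jumpCount at h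
    rcases le_total s t with hst | hst
    · have h1 := Int.floor_mono hst
      have h2 := Int.floor_mono (sub_le_sub_right hst b)
      have h3 := Int.ceil_mono (sub_le_sub_right hst c)
      omega
    · have h1 := Int.floor_mono hst
      have h2 := Int.floor_mono (sub_le_sub_right hst b)
      have h3 := Int.ceil_mono (sub_le_sub_right hst c)
      omega
  obtain ⟨h1, h2, h3⟩ := hfl
  have hb : ∀ x : ℝ, ⌊x⌋ = ⌊t⌋ → (b ≤ Int.fract x ↔ ⌊t⌋ ≤ ⌊x - b⌋) := by
    intro x hx
    rw [Int.le_floor, ← Int.self_sub_floor, hx]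
    constructor <;> intro <;> linarith
  have hc : ∀ x : ℝ, ⌊x⌋ = ⌊t⌋ → (Int.fract x ≤ c ↔ ⌈x - c⌉ ≤ ⌊t⌋) := by
    intro x hx
    rw [Int.ceil_le, ← Int.self_sub_floor, hx]
    constructor <;> intro <;> linarith
  have hbs := hb s h1
  have hbt := hb t rfl
  have hcs := hc s h1
  have hct := hc t rfl
  rw [h2, ← hbt] at hbs
  rw [h3, ← hct] at hcs
  have hfs : Int.fract t - Int.fract s = t - s := by
    rw [← Int.self_sub_floor, ← Int.self_sub_floor, h1]; ring
  unfold hitLength hitIndicator clampLength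
  rw [h1]
  by_cases hcase : Int.fract s ∈ Set.Icc b c
  · rw [if_pos hcase, min_eq_left hcase.2, max_eq_right hcase.1, min_eq_left (hcs.mp hcase.2),
      max_eq_right (hbs.mp hcase.1)]
    linarith
  · rw [if_neg hcase, zero_mul]
    rcases lt_or_ge (Int.fract s) b with hlt | hge
    · have hlt' : Int.fract t < b := not_le.mp (fun hh => absurd (hbs.mpr hh) (not_le.mpr hlt))
      rw [max_eq_left ((min_le_left _ _).trans hlt.le), max_eq_left ((min_le_left _ _).trans hlt'.le)]
      ring
    · have hgt : c < Int.fract s := not_le.mp (fun hh => hcase ⟨hge, hh⟩)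
      have hgt' : c < Int.fract t := not_le.mp (fun hh => absurd (hcs.mpr hh) (not_le.mpr hgt))
      rw [min_eq_right hgt.le, min_eq_right hgt'.le]
      ring

/-- Without a boundary crossing the slope equals the indicator. Otherwise both lie in [0, 1] and the
jump count changes by at least 1. -/
lemma abs_hitIndicator_sub_slope_le (hb : 0 ≤ b) (hbc : b ≤ c) (hc : c ≤ 1) {s t : ℝ}
    (hst : s ≠ t) :
    |hitIndicator b c s - (hitLength b c t - hitLength b c s) / (t - s)| ≤
      |((jumpCount b c t : ℤ) : ℝ) - (jumpCount b c s : ℤ)| := by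
  have hts : t - s ≠ 0 := sub_ne_zero.mpr hst.symm
  by_cases h : jumpCount b c s = jumpCount b c t
  · rw [hitLength_sub_of_jumpCount_eq h, mul_div_cancel_right₀ _ hts, sub_self, abs_zero]
    exact abs_nonneg _
  · have h1 : (1 : ℝ) ≤ |((jumpCount b c t : ℤ) : ℝ) - (jumpCount b c s : ℤ)| := by
      have : 1 ≤ |jumpCount b c t - jumpCount b c s| :=
        Int.one_le_abs (sub_ne_zero.mpr (Ne.symm h))
      exact_mod_cast this
    refine le_trans ?_ h1
    have h2 : 0 ≤ (hitLength b c t - hitLength b c s) / (t - s) ∧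
        (hitLength b c t - hitLength b c s) / (t - s) ≤ 1 := by
      rcases lt_or_gt_of_ne hst with h3 | h3
      · obtain ⟨h4, h5⟩ := hitLength_sub_mem hb hbc hc h3.le
        have h6 : 0 < t - s := by linarith
        exact ⟨div_nonneg h4 h6.le, (div_le_one h6).mpr h5⟩
      · obtain ⟨h4, h5⟩ := hitLength_sub_mem hb hbc hc h3.le
        have h6 : 0 < s - t := by linarith
        have h7 : (hitLength b c t - hitLength b c s) / (t - s) =
            (hitLength b c s - hitLength b c t) / (s - t) := by
          rw [← neg_sub, ← neg_sub s t, neg_div_neg_eq]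
        rw [h7]
        exact ⟨div_nonneg h4 h6.le, (div_le_one h6).mpr h5⟩
    have h8 : hitIndicator b c s = 0 ∨ hitIndicator b c s = 1 := by
      unfold hitIndicator; split_ifs <;> simp
    rw [abs_le]
    rcases h8 with h8 | h8 <;> rw [h8] <;> constructor <;> linarith

end

lemma sum_abs_sub_of_monotone {v : ℕ → ℝ} (hv : Monotone v) (N : ℕ) :
    ∑ n ∈ Finset.range N, |v (n + 1) - v n| = |v N - v 0| := by
  rw [abs_of_nonneg (sub_nonneg.mpr (hv N.zero_le)), ← Finset.sum_range_sub]
  exact Finset.sum_congr rfl fun n _ => abs_of_nonneg (sub_nonneg.mpr (hv n.le_succ))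

lemma sum_abs_sub_of_antitone {v : ℕ → ℝ} (hv : Antitone v) (N : ℕ) :
    ∑ n ∈ Finset.range N, |v (n + 1) - v n| = |v N - v 0| := by
  have h := sum_abs_sub_of_monotone (v := fun n => -v n) hv.neg N
  simpa only [neg_sub_neg, abs_sub_comm] using h

/-- Summation by parts: bounded E against increasing weights costs only the last weight. -/
lemma abs_sum_sub_mul_le {E w : ℕ → ℝ} (hE : ∀ n, |E n| ≤ 1) (hw : Monotone w) (hw0 : 0 ≤ w 0)
    (N : ℕ) : |∑ n ∈ Finset.range N, (E (n + 1) - E n) * w n| ≤ 2 * w N := by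
  have h1 : ∀ n, |∑ k ∈ Finset.range n, (E (k + 1) - E k) * w k - E n * w n + E 0 * w 0| ≤
      w n - w 0 := by
    intro n
    induction n with
    | zero => simp
    | succ n ih =>
      have h2 : ∑ k ∈ Finset.range (n + 1), (E (k + 1) - E k) * w k - E (n + 1) * w (n + 1) +
          E 0 * w 0 = (∑ k ∈ Finset.range n, (E (k + 1) - E k) * w k - E n * w n + E 0 * w 0) +
          E (n + 1) * (w n - w (n + 1)) := by
        rw [Finset.sum_range_succ]; ring
      rw [h2]
      refine (abs_add_le _ _).trans ?_
      have h3 := hw n.le_succ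
      rw [abs_mul, abs_sub_comm, abs_of_nonneg (sub_nonneg.mpr h3)]
      have h4 := mul_le_mul_of_nonneg_right (hE (n + 1)) (sub_nonneg.mpr h3)
      linarith
  have h5 := abs_le.mp (h1 N)
  have h6 : ∀ n, |E n * w n| ≤ w n := by
    intro n
    have := hw0.trans (hw n.zero_le)
    rw [abs_mul, abs_of_nonneg this]
    nlinarith [hE n]
  have h7 := abs_le.mp (h6 N)
  have h8 := abs_le.mp (h6 0)
  rw [abs_le]
  constructor <;> linarith

lemma card_filter_eq_sum (b c : ℝ) (u : ℕ → ℝ) (N : ℕ) [DecidablePred fun n => Int.fract (u n) ∈ Set.Icc b c] :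
    ((((Finset.range N).filter (fun n => Int.fract (u n) ∈ Set.Icc b c)).card : ℕ) : ℝ) =
      ∑ n ∈ Finset.range N, hitIndicator b c (u n) := by
  rw [Finset.natCast_card_filter]
  refine Finset.sum_congr rfl fun n _ => ?_
  unfold hitIndicator
  congr

/-- **Fejér's criterion**: a sequence whose gaps decrease to `0`, but not too fast, is uniformly
distributed modulo one after any dilation. -/
theorem uniformlyDistributed_of_antitone_gap {g : ℕ → ℝ} (hg : StrictMono g)
    (hanti : Antitone fun n => g (n + 1) - g n)
    (hzero : Tendsto (fun n => g (n + 1) - g n) atTop (𝓝 0))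
    (hinv : Tendsto (fun n : ℕ => (g (n + 1) - g n)⁻¹ / (n : ℝ)) atTop (𝓝 0))
    {α : ℝ} (hα : α ≠ 0) : UniformlyDistributedModOne fun n => α * g n := by
  classical
  intro b c hb hbc hc
  have hpos : ∀ n, 0 < g (n + 1) - g n := fun n => sub_pos.mpr (hg n.lt_succ_self)
  -- The indicator is replaced by the slope of `hitLength`. The first two terms count the boundary
  -- points crossed; the last bounds the periodic error weighted by reciprocal gaps.
  have hbound : ∀ N : ℕ, |∑ n ∈ Finset.range N, hitIndicator b c (α * g n) - (c - b) * N| ≤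
      3 * |α| * (g N - g 0) + 3 + 2 / |α| * (g (N + 1) - g N)⁻¹ := by
    intro N
    set t : ℕ → ℝ := fun n => α * g n with ht
    set E : ℕ → ℝ := fun n => hitLength b c (t n) - (c - b) * t n with hE
    set w : ℕ → ℝ := fun n => (g (n + 1) - g n)⁻¹ with hw
    have htd : ∀ n, t (n + 1) - t n = α * (g (n + 1) - g n) := fun n => by simp only [ht]; ring
    have hne : ∀ n, t n ≠ t (n + 1) := by
      intro n h
      have h1 := htd n
      rw [h, sub_self] at h1
      exact mul_ne_zero hα (hpos n).ne' h1.symm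
    have hslope : ∀ n, (hitLength b c (t (n + 1)) - hitLength b c (t n)) / (t (n + 1) - t n) =
        (c - b) + α⁻¹ * ((E (n + 1) - E n) * w n) := by
      intro n
      have h1 := (hpos n).ne'
      simp only [hE, hw]
      rw [htd n]
      have h2 := htd n
      field_simp
      linear_combination (-(c - b)) * h2
    have h1 : ∑ n ∈ Finset.range N, hitIndicator b c (t n) - (c - b) * N =
        ∑ n ∈ Finset.range N, (hitIndicator b c (t n) -
          (hitLength b c (t (n + 1)) - hitLength b c (t n)) / (t (n + 1) - t n)) +
        α⁻¹ * ∑ n ∈ Finset.range N, (E (n + 1) - E n) * w n := by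
      rw [Finset.sum_sub_distrib, Finset.sum_congr rfl (fun n _ => hslope n),
        Finset.sum_add_distrib, Finset.mul_sum]
      simp
      ring
    have h2 : |∑ n ∈ Finset.range N, (hitIndicator b c (t n) -
          (hitLength b c (t (n + 1)) - hitLength b c (t n)) / (t (n + 1) - t n))| ≤
        3 * |α| * (g N - g 0) + 3 := by
      refine (Finset.abs_sum_le_sum_abs _ _).trans ((Finset.sum_le_sum fun n _ =>
        abs_hitIndicator_sub_slope_le hb hbc hc (hne n)).trans ?_)
      have h3 : ∑ n ∈ Finset.range N, |((jumpCount b c (t (n + 1)) : ℤ) : ℝ) -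
          (jumpCount b c (t n) : ℤ)| =
          |((jumpCount b c (t N) : ℤ) : ℝ) - (jumpCount b c (t 0) : ℤ)| := by
        have hcast : Monotone fun x => ((jumpCount b c x : ℤ) : ℝ) := fun _ _ hxy =>
          Int.cast_le.mpr (jumpCount_mono hxy)
        rcases lt_or_gt_of_ne hα with h | h
        · exact sum_abs_sub_of_antitone (v := fun n => ((jumpCount b c (t n) : ℤ) : ℝ))
            (hcast.comp_antitone fun m n hmn =>
              mul_le_mul_of_nonpos_left (hg.monotone hmn) h.le) N
        · exact sum_abs_sub_of_monotone (v := fun n => ((jumpCount b c (t n) : ℤ) : ℝ))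
            (hcast.comp fun m n hmn =>
              mul_le_mul_of_nonneg_left (hg.monotone hmn) h.le) N
      rw [h3]
      refine (abs_jumpCount_sub_le _ _).trans (le_of_eq ?_)
      have h4 : t N - t 0 = α * (g N - g 0) := by simp only [ht]; ring
      rw [h4, abs_mul, abs_of_nonneg (sub_nonneg.mpr (hg.monotone N.zero_le))]
      ring
    have h5 := abs_sum_sub_mul_le (E := E) (w := w)
      (fun n => abs_hitLength_sub_le hb hbc hc (t n))
      (fun m n hmn => inv_anti₀ (hpos n) (hanti hmn)) (inv_nonneg.mpr (hpos 0).le) N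
    rw [h1]
    refine (abs_add_le _ _).trans (add_le_add h2 ?_)
    rw [abs_mul, abs_inv]
    have h6 : 2 / |α| * (g (N + 1) - g N)⁻¹ = |α|⁻¹ * (2 * w N) := by simp only [hw]; ring
    rw [h6]
    exact mul_le_mul_of_nonneg_left h5 (by positivity)
  -- Gaps tending to 0 have averages tending to 0, so g N = o(N).
  have hces : Tendsto (fun N : ℕ => (g N - g 0) / (N : ℝ)) atTop (𝓝 0) := by
    have := hzero.cesaro
    simp_rw [Finset.sum_range_sub] at this
    refine this.congr fun N => by ring
  have hlim : Tendsto (fun N : ℕ => 3 * |α| * ((g N - g 0) / (N : ℝ)) + 3 / (N : ℝ) +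
      2 / |α| * ((g (N + 1) - g N)⁻¹ / (N : ℝ))) atTop (𝓝 0) := by
    have h1 := ((hces.const_mul (3 * |α|)).add (tendsto_const_div_atTop_nhds_zero_nat 3)).add
      (hinv.const_mul (2 / |α|))
    simpa using h1
  rw [← tendsto_sub_nhds_zero_iff]
  refine squeeze_zero_norm' ?_ hlim
  filter_upwards [eventually_gt_atTop 0] with N hN
  have hN0 : (0 : ℝ) < N := by exact_mod_cast hN
  rw [card_filter_eq_sum b c (fun n => α * g n), Real.norm_eq_abs]
  have h1 : (∑ n ∈ Finset.range N, hitIndicator b c (α * g n)) / (N : ℝ) - (c - b) =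
      (∑ n ∈ Finset.range N, hitIndicator b c (α * g n) - (c - b) * N) / N := by
    field_simp
  rw [h1, abs_div, abs_of_pos hN0, div_le_iff₀ hN0]
  refine (hbound N).trans (le_of_eq ?_)
  field_simp

lemma UniformlyDistributedModOne.of_shift {u : ℕ → ℝ} (m : ℕ)
    (h : UniformlyDistributedModOne fun n => u (m + n)) : UniformlyDistributedModOne u := by
  classical
  intro b c hb hbc hc
  have h1 := h b c hb hbc hc
  rw [← tendsto_add_atTop_iff_nat m]
  have h2 : Tendsto (fun N : ℕ => ((N : ℝ) / ((N : ℝ) + m))) atTop (𝓝 1) :=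
    tendsto_natCast_div_add_atTop (m : ℝ)
  have h3 : Tendsto (fun N : ℕ => (∑ n ∈ Finset.range m, hitIndicator b c (u n)) /
      ((N : ℝ) + m)) atTop (𝓝 0) :=
    tendsto_const_nhds.div_atTop (tendsto_atTop_add_const_right _ _ tendsto_natCast_atTop_atTop)
  have h4 := (h1.mul h2).add h3
  rw [mul_one, add_zero] at h4
  refine h4.congr' ?_
  filter_upwards [eventually_gt_atTop 0] with N hN
  have hN0 : (0 : ℝ) < N := by exact_mod_cast hN
  rw [card_filter_eq_sum b c u, card_filter_eq_sum b c (fun n => u (m + n)), add_comm N m,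
    Finset.sum_range_add]
  push_cast
  field_simp
  ring

/-! ### Low a-points and enumerations -/

namespace GammaData

/-- An entire function vanishing at the nontrivial `a`-points. -/
noncomputable def pointFunction (D : GammaData) (a s : ℂ) : ℂ :=
  D.omega * (D.Q : ℂ) ^ (1 - 2 * s) * ∏ j, (Complex.Gamma (D.argPlus j s))⁻¹ -
    a * ∏ j, (Complex.Gamma (D.argMinus j s))⁻¹

variable {D : GammaData} {a : ℂ} {K : ℝ} {p : ℕ → ℂ}

lemma differentiable_pointFunction (D : GammaData) (a : ℂ) :
    Differentiable ℂ (D.pointFunction a) := by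
  have hQ : (D.Q : ℂ) ≠ 0 := by exact_mod_cast D.Q_pos.ne'
  have h1 : ∀ j, Differentiable ℂ fun s => (Complex.Gamma (D.argPlus j s))⁻¹ := fun j =>
    Complex.differentiable_one_div_Gamma.comp fun s =>
      (D.hasDerivAt_argPlus j s).differentiableAt
  have h2 : ∀ j, Differentiable ℂ fun s => (Complex.Gamma (D.argMinus j s))⁻¹ := fun j =>
    Complex.differentiable_one_div_Gamma.comp fun s =>
      (D.hasDerivAt_argMinus j s).differentiableAt
  have h3 : Differentiable ℂ fun s : ℂ => (D.Q : ℂ) ^ (1 - 2 * s) := fun s =>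
    DifferentiableAt.const_cpow (by fun_prop) (Or.inl hQ)
  exact ((h3.const_mul _).mul (Differentiable.fun_finsetProd fun j _ => h1 j)).sub
    ((Differentiable.fun_finsetProd fun j _ => h2 j).const_mul _)

lemma pointFunction_eq_zero_iff {s : ℂ} (hs : ∀ j, Complex.Gamma (D.argMinus j s) ≠ 0) :
    D.pointFunction a s = 0 ↔ D.Delta s = a := by
  have hprod : ∏ j, Complex.Gamma (D.argMinus j s) ≠ 0 :=
    Finset.prod_ne_zero_iff.mpr fun j _ => hs j
  have h1 : D.Delta s = D.omega * (D.Q : ℂ) ^ (1 - 2 * s) *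
      (∏ j, Complex.Gamma (D.argMinus j s)) * ∏ j, (Complex.Gamma (D.argPlus j s))⁻¹ := by
    rw [Delta, mul_assoc _ (∏ j, Complex.Gamma (D.argMinus j s)), ← Finset.prod_mul_distrib]
    simp only [div_eq_mul_inv]
    rfl
  have h2 : D.pointFunction a s * ∏ j, Complex.Gamma (D.argMinus j s) = D.Delta s - a := by
    rw [h1, pointFunction, Finset.prod_inv_distrib (f := fun j => Complex.Gamma (D.argMinus j s))]
    field_simp
  constructor
  · intro h
    rw [h, zero_mul] at h2
    exact (sub_eq_zero.mp h2.symm)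
  · intro h
    rw [h, sub_self] at h2
    exact (mul_eq_zero.mp h2).resolve_right hprod

/-- At a pole the formal value of Γ is 0, which would make Δ(s) = 0 ≠ a. -/
lemma Gamma_argMinus_ne_zero (ha : a ≠ 0) {s : ℂ} (hs : D.Delta s = a) (j : Fin D.r) :
    Complex.Gamma (D.argMinus j s) ≠ 0 := by
  intro h
  apply ha
  rw [← hs, Delta]
  refine mul_eq_zero_of_right _ (Finset.prod_eq_zero (Finset.mem_univ j) ?_)
  rw [div_eq_zero_iff]
  exact Or.inl h

lemma pointFunction_eq_zero (ha : a ≠ 0) {s : ℂ} (hs : D.Delta s = a) :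
    D.pointFunction a s = 0 :=
  (pointFunction_eq_zero_iff fun j => Gamma_argMinus_ne_zero ha hs j).mpr hs

namespace IsPointSequence

variable (hp : D.IsPointSequence a K p)
include hp

/-- By the identity theorem accumulating zeros would make the entire function vanish identically;
then Δ = a near p 0, against the simplicity of that point. -/
lemma not_frequently_pointFunction_eq_zero (ha : a ≠ 0) (z : ℂ) :
    ¬∃ᶠ s in 𝓝[≠] z, D.pointFunction a s = 0 := by
  intro hz
  have han : AnalyticOnNhd ℂ (D.pointFunction a) Set.univ := fun s _ =>
    (D.differentiable_pointFunction a).analyticAt s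
  have hall := han.eqOn_zero_of_preconnected_of_frequently_eq_zero isPreconnected_univ
    (Set.mem_univ z) hz
  have hΔ := (hp.mem 0).1
  have hev : ∀ᶠ s in 𝓝 (p 0), ∀ j, Complex.Gamma (D.argMinus j s) ≠ 0 := by
    rw [eventually_all]
    intro j
    have hcont : Continuous fun s => (Complex.Gamma (D.argMinus j s))⁻¹ :=
      (Complex.differentiable_one_div_Gamma.comp fun s =>
        (D.hasDerivAt_argMinus j s).differentiableAt).continuous
    have hne := hcont.continuousAt.eventually_ne
      (inv_ne_zero (Gamma_argMinus_ne_zero ha hΔ j))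
    exact hne.mono fun s hs h => hs (by rw [h, inv_zero])
  have htop : D.multiplicity a (p 0) = ⊤ := by
    rw [multiplicity, analyticOrderAt_eq_top]
    filter_upwards [hev] with s hs
    rw [(pointFunction_eq_zero_iff hs).mp (hall (Set.mem_univ s)), sub_self]
  rw [hp.multiplicity_eq 0] at htop
  exact ENat.one_ne_top htop

lemma multiplicity_ne_top (ha : a ≠ 0) (s : ℂ) : D.multiplicity a s ≠ ⊤ := by
  intro h
  rw [multiplicity, analyticOrderAt_eq_top] at h
  refine hp.not_frequently_pointFunction_eq_zero ha s (Eventually.frequently ?_)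
  filter_upwards [nhdsWithin_le_nhds h] with z hz
  exact pointFunction_eq_zero ha (sub_eq_zero.mp hz)

/-- Infinitely many points in a compact rectangle would accumulate, and they are zeros of the entire
function. -/
lemma finite_low_points (ha : a ≠ 0) (B : ℝ) :
    {s | s ∈ D.nontrivialPoints a ∧ 0 < s.im ∧ s.im < B}.Finite := by
  by_contra hinf
  have hsub : {s | s ∈ D.nontrivialPoints a ∧ 0 < s.im ∧ s.im < B} ⊆
      Set.Icc 0 1 ×ℂ Set.Icc 0 B := fun s hs =>
    ⟨⟨hs.1.2.1, hs.1.2.2⟩, ⟨hs.2.1.le, hs.2.2.le⟩⟩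
  obtain ⟨z, _, hz⟩ := Set.Infinite.exists_accPt_of_subset_isCompact hinf
    (isCompact_Icc.reProdIm isCompact_Icc) hsub
  rw [accPt_iff_frequently_nhdsNE] at hz
  exact hp.not_frequently_pointFunction_eq_zero ha z
    (hz.mono fun s hs => pointFunction_eq_zero ha hs.1.1)

/-- The nontrivial `a`-points with positive ordinate can be enumerated. -/
theorem exists_isEnumeration (ha : a ≠ 0) : ∃ δ : ℕ → ℂ, D.IsEnumeration a δ := by
  classical
  set A := (hp.finite_low_points ha (p 0).im).toFinset with hA
  have hmemA : ∀ s, s ∈ A ↔ s ∈ D.nontrivialPoints a ∧ 0 < s.im ∧ s.im < (p 0).im := fun s => by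
    rw [hA, Set.Finite.mem_toFinset]; rfl
  -- One label for each low point and each copy required by its multiplicity; the labels are sorted
  -- by ordinate and then followed by p.
  let ι := Σ s : A, Fin (D.multiplicity a s.1).toNat
  set m := Fintype.card ι
  let e : ι ≃ Fin m := Fintype.equivFin ι
  let f : Fin m → ℂ := fun i => (e.symm i).1.1
  let σ := Tuple.sort fun i => (f i).im
  have hσ : Monotone fun i => (f (σ i)).im := Tuple.monotone_sort fun i => (f i).im
  have hfA : ∀ i, f i ∈ A := fun i => (e.symm i).1.2
  let δ : ℕ → ℂ := fun n => if h : n < m then f (σ ⟨n, h⟩) else p (n - m)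
  have hδ1 : ∀ i : Fin m, δ i = f (σ i) := fun i => dif_pos i.2
  have hδ2 : ∀ n, m ≤ n → δ n = p (n - m) := fun n hn => dif_neg (not_lt.mpr hn)
  refine ⟨δ, ?_, ?_⟩
  · intro k n hkn
    simp only
    rcases lt_or_ge n m with hn | hn
    · rw [hδ1 ⟨n, hn⟩, hδ1 ⟨k, hkn.trans_lt hn⟩]
      exact hσ hkn
    · rw [hδ2 n hn]
      rcases lt_or_ge k m with hk | hk
      · rw [hδ1 ⟨k, hk⟩]
        exact ((hmemA _).mp (hfA _)).2.2.le.trans (hp.strictMono.monotone (Nat.zero_le _))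
      · rw [hδ2 k hk]
        exact hp.strictMono.monotone (by omega)
  · intro s
    have hlow : ∀ n, n < m → δ n = s → s ∈ A := by
      intro n hn h
      rw [← h, hδ1 ⟨n, hn⟩]
      exact hfA _
    have hhigh : ∀ n, m ≤ n → δ n = s → s ∈ D.nontrivialPoints a ∧ (p 0).im ≤ s.im := by
      intro n hn h
      rw [← h, hδ2 n hn]
      exact ⟨hp.mem _, hp.strictMono.monotone (Nat.zero_le _)⟩
    have him0 : 0 < (p 0).im := by linarith [hp.one_le_im]
    by_cases hsA : s ∈ A
    · have hs := (hmemA s).mp hsA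
      rw [if_pos ⟨hs.1, hs.2.1⟩]
      have hset : {n | δ n = s} =
          (fun k : Fin (D.multiplicity a s).toNat => ((σ.symm (e ⟨⟨s, hsA⟩, k⟩) : Fin m) : ℕ)) ''
            Set.univ := by
        ext n
        constructor
        · intro h
          have hn : n < m := by
            by_contra hn
            have := (hhigh n (not_lt.mp hn) h).2
            linarith [hs.2.2]
          have h1 : f (σ ⟨n, hn⟩) = s := by rw [← hδ1 ⟨n, hn⟩]; exact h
          obtain ⟨⟨s', k⟩, hx⟩ : ∃ x, e.symm (σ ⟨n, hn⟩) = x := ⟨_, rfl⟩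
          have h2 : s'.1 = s := by rw [← h1]; simp only [f, hx]
          obtain ⟨s', hs'⟩ := s'
          simp only at h2
          subst h2
          refine ⟨k, Set.mem_univ _, ?_⟩
          simp only
          rw [← hx, Equiv.apply_symm_apply, Equiv.symm_apply_apply]
        · rintro ⟨k, -, rfl⟩
          change δ _ = s
          rw [hδ1, Equiv.apply_symm_apply]
          simp [f]
      rw [hset, Function.Injective.encard_image, Set.encard_univ]
      · simp only [ENat.card_eq_coe_fintype_card, Fintype.card_fin]
        exact ENat.natCast_toNat (hp.multiplicity_ne_top ha s)
      · intro k k' h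
        have h1 := σ.symm.injective (Fin.val_injective h)
        have h2 := e.injective h1
        exact eq_of_heq (Sigma.mk.inj_iff.mp h2).2
    · by_cases hsp : s ∈ D.nontrivialPoints a ∧ 0 < s.im
      · rw [if_pos hsp]
        have hge : (p 0).im ≤ s.im := by
          by_contra hlt
          exact hsA ((hmemA s).mpr ⟨hsp.1, hsp.2, not_le.mp hlt⟩)
        obtain ⟨n, rfl⟩ := hp.surj s hsp.1 hge
        rw [hp.multiplicity_eq, Set.encard_eq_one]
        refine ⟨m + n, Set.eq_singleton_iff_unique_mem.mpr ⟨?_, ?_⟩⟩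
        · change δ _ = _
          rw [hδ2 _ (Nat.le_add_right _ _), Nat.add_sub_cancel_left]
        · intro k hk
          have hkm : m ≤ k := not_lt.mp fun h => hsA (hlow k h hk)
          have h1 : p (k - m) = p n := by rw [← hδ2 k hkm]; exact hk
          have := hp.injective h1
          omega
      · rw [if_neg hsp, Set.encard_eq_zero, Set.eq_empty_iff_forall_notMem]
        intro n hn
        rcases lt_or_ge n m with h | h
        · have := (hmemA s).mp (hlow n h hn)
          exact hsp ⟨this.1, this.2.1⟩
        · have := hhigh n h hn
          exact hsp ⟨this.1, him0.trans_le this.2⟩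

/-- Every enumeration coincides with the point sequence from some index on. -/
lemma exists_shift_of_isEnumeration (ha : a ≠ 0) {δ : ℕ → ℂ} (hδ : D.IsEnumeration a δ) :
    ∃ m, ∀ k, δ (m + k) = p k := by
  classical
  obtain ⟨hmono, hcount⟩ := hδ
  have hmem : ∀ n, δ n ∈ D.nontrivialPoints a ∧ 0 < (δ n).im := by
    intro n
    by_contra h
    have h1 := hcount (δ n)
    rw [if_neg h, Set.encard_eq_zero] at h1
    exact (Set.eq_empty_iff_forall_notMem.mp h1) n rfl
  have hfib : ∀ s, {n | δ n = s}.Finite := by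
    intro s
    rw [← Set.encard_ne_top_iff, hcount s]
    split_ifs
    · exact hp.multiplicity_ne_top ha s
    · exact ENat.zero_ne_top
  have hfib1 : ∀ j, ∃ n, {n | δ n = p j} = {n} := by
    intro j
    rw [← Set.encard_eq_one, hcount, if_pos ⟨hp.mem j, by linarith [hp.one_le_im' j]⟩,
      hp.multiplicity_eq]
  have hex : ∃ n, (p 0).im ≤ (δ n).im := by
    by_contra! hlt
    have hfin : (⋃ s ∈ {s | s ∈ D.nontrivialPoints a ∧ 0 < s.im ∧ s.im < (p 0).im},
        {n | δ n = s}).Finite :=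
      (hp.finite_low_points ha _).biUnion fun s _ => hfib s
    refine Set.infinite_univ (hfin.subset fun n _ => ?_)
    simp only [Set.mem_iUnion]
    exact ⟨δ n, ⟨(hmem n).1, (hmem n).2, hlt n⟩, rfl⟩
  set m := Nat.find hex
  have hge : ∀ k, (p 0).im ≤ (δ (m + k)).im := fun k =>
    (Nat.find_spec hex).trans (hmono (Nat.le_add_right _ _))
  -- From index m on, δ runs through p via an index map τ. It is monotone by the ordering and
  -- bijective because every p j is listed exactly once, so it is the identity on ℕ.
  choose τ hτ using fun k => hp.surj (δ (m + k)) (hmem _).1 (hge k)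
  have hτmono : Monotone τ := by
    intro k k' hkk
    have h1 : (δ (m + k)).im ≤ (δ (m + k')).im := hmono (by omega)
    rw [← hτ k, ← hτ k'] at h1
    exact hp.strictMono.le_iff_le.mp h1
  have hτinj : Function.Injective τ := by
    intro k k' hkk
    obtain ⟨n, hn⟩ := hfib1 (τ k)
    have h1 : m + k ∈ {n | δ n = p (τ k)} := (hτ k).symm
    have h2 : m + k' ∈ {n | δ n = p (τ k)} := by rw [hkk]; exact (hτ k').symm
    rw [hn, Set.mem_singleton_iff] at h1 h2
    omega
  have hτsurj : Function.Surjective τ := by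
    intro j
    obtain ⟨n, hn⟩ := hfib1 j
    have h1 : δ n = p j := by
      have : n ∈ {n | δ n = p j} := by rw [hn]; rfl
      exact this
    have h2 : m ≤ n := by
      refine Nat.find_min' hex ?_
      rw [h1]
      exact hp.strictMono.monotone j.zero_le
    refine ⟨n - m, hp.injective ?_⟩
    rw [hτ, show m + (n - m) = n by omega, h1]
  have hτid : τ = id := by
    refine ((hτmono.strictMono_of_injective hτinj).range_inj strictMono_id).mp ?_
    rw [hτsurj.range_eq, Set.range_id]
  refine ⟨m, fun k => ?_⟩
  rw [← hτ k, hτid, id]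

lemma tendsto_gap (hd : 0 < D.degree) :
    Tendsto (fun n => (p (n + 1)).im - (p n).im) atTop (𝓝 0) := by
  have h1 : Tendsto (fun n => D.ell (p n).im - K) atTop atTop :=
    tendsto_atTop_add_const_right _ _ ((D.tendsto_ell hd).comp (hp.tendsto_im hd))
  have h2 : Tendsto (fun n => 2 * Real.pi / (D.ell (p n).im - K)) atTop (𝓝 0) :=
    tendsto_const_nhds.div_atTop h1
  refine squeeze_zero' (Eventually.of_forall fun n => (hp.gap_pos n).le) ?_ h2
  filter_upwards [h1.eventually_gt_atTop 0] with n hn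
  rw [le_div_iff₀ hn]
  refine (mul_le_mul_of_nonneg_left ?_ (hp.gap_pos n).le).trans (hp.gap_le n)
  have := div_le_self hp.K_nonneg (hp.one_le_im' n)
  linarith

/-- The reciprocal gap is at most ℓ(γ_{n+1}), hence O(γ_{n+1}) by log t ≤ t; and γ_n = o(n) because
the gaps tend to 0. -/
lemma tendsto_inv_gap_div (hd : 0 < D.degree) :
    Tendsto (fun n : ℕ => ((p (n + 1)).im - (p n).im)⁻¹ / (n : ℝ)) atTop (𝓝 0) := by
  set A := |Real.log (D.lamProd * D.Q ^ 2)| + D.degree with hA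
  have hces := (hp.tendsto_gap hd).cesaro
  simp_rw [Finset.sum_range_sub (fun n => (p n).im)] at hces
  have hlim : Tendsto (fun n : ℕ => A * ((n : ℝ)⁻¹ * ((p n).im - (p 0).im) +
      ((p 0).im + 2 * Real.pi) / n)) atTop (𝓝 0) := by
    have := (hces.add (tendsto_const_div_atTop_nhds_zero_nat ((p 0).im + 2 * Real.pi))).const_mul A
    simpa using this
  refine squeeze_zero' (Eventually.of_forall fun n => ?_) (Eventually.of_forall fun n => ?_) hlim
  · have := (hp.gap_pos n).le
    positivity
  · have h1 : ((p (n + 1)).im - (p n).im)⁻¹ ≤ D.ell (p (n + 1)).im := by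
      rw [inv_le_iff_one_le_mul₀ (hp.gap_pos n), mul_comm]
      exact hp.one_le_gap n
    have h2 : D.ell (p (n + 1)).im ≤ A * (p (n + 1)).im := by
      have h3 := hp.one_le_im' (n + 1)
      have h4 := Real.log_le_self (show 0 ≤ (p (n + 1)).im by linarith)
      have h5 := le_abs_self (Real.log (D.lamProd * D.Q ^ 2))
      have h6 := abs_nonneg (Real.log (D.lamProd * D.Q ^ 2))
      rw [ell, hA]
      nlinarith
    have h7 : (p (n + 1)).im ≤ ((p n).im - (p 0).im) + ((p 0).im + 2 * Real.pi) := by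
      linarith [hp.gap_le_two_pi n]
    have hA0 : 0 ≤ A := by positivity
    have h8 := h1.trans (h2.trans (mul_le_mul_of_nonneg_left h7 hA0))
    refine (div_le_div_of_nonneg_right h8 n.cast_nonneg).trans (le_of_eq ?_)
    ring

theorem uniformlyDistributed (hd : 0 < D.degree) (ha : a ≠ 0) {δ : ℕ → ℂ}
    (hδ : D.IsEnumeration a δ) {α : ℝ} (hα : α ≠ 0) :
    UniformlyDistributedModOne fun n => α * (δ n).im := by
  obtain ⟨m, hm⟩ := hp.exists_shift_of_isEnumeration ha hδ
  refine UniformlyDistributedModOne.of_shift m ?_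
  simp_rw [hm]
  exact uniformlyDistributed_of_antitone_gap hp.strictMono hp.gap_antitone (hp.tendsto_gap hd)
    (hp.tendsto_inv_gap_div hd) hα

end IsPointSequence

end GammaData

end SelbergDelta

theorem corollary1 (a : ℂ) (ha : a ≠ 0) (L : ℂ → ℂ) (D : SelbergDelta.GammaData)
    (hL : SelbergDelta.IsExtendedSelberg L D) (hd : 1 ≤ D.degree) :
    (∀ y : ℝ → ℝ, (∀ᶠ t in Filter.atTop, 2 ≤ y t ∧ 4 * |D.Theta| * y t ≤ t) →
      ∃ T₀ C : ℝ, 0 < T₀ ∧ ∀ T : ℝ, T₀ ≤ T → ∀ x : ℝ, 0 < x → x ≠ 1 →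
        max x (1 / x) ≤ (1 - 1 / y T) * (D.lamProd * D.Q ^ 2 * T ^ D.degree) →
        (D.pointsBetween a T (2 * T)).Finite ∧
        ‖D.ordinateSum a x T (2 * T)‖ ≤
          C * ((1 + |Real.log x|) *
            (Real.log T / |Real.log x| + SelbergDelta.psi T + y T * |Real.log x|))) ∧
    (∃ δ : ℕ → ℂ, D.IsEnumeration a δ) ∧
    (∀ δ : ℕ → ℂ, D.IsEnumeration a δ → ∀ α : ℝ, α ≠ 0 →
      SelbergDelta.UniformlyDistributedModOne (fun n => α * (δ n).im)) := by
  have hd0 : 0 < D.degree := by linarith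
  obtain ⟨K, p, hp⟩ := SelbergDelta.GammaData.exists_isPointSequence D hd0 ha
  exact ⟨fun y hy => hp.ordinateSum_bound hd0 (hy.mono fun _ h => h.1),
    hp.exists_isEnumeration ha, fun δ hδ α hα => hp.uniformlyDistributed hd0 ha hδ hα⟩
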